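/- **Setting.** Work in continuous logic. Let $L_N$ be the language of real Hilbert spaces (sorts: the balls of integer radius around $0$; symbols $0$, $+$, multiplication by each real, $\langle\cdot,\cdot\rangle$, the metric) together with a unary predicate $d_N$ with values in $[0,1]$. Let $T_0$ be the theory of structures $(H,d_N)$, $H$ a real Hilbert space and $d_N:H\to[0,1]$, with (1) $\sup_x\min\{1\mathbin{\dot-}d_N(x),\ \inf_y\max\{|d_N(x)-\|x-y\||,\,d_N(y)\}\}=0$ and (2) $\sup_x\sup_y\,[d_N(y)-\|x-y\|-d_N(x)]\le 0$. *Loci.* A locus is given by $n,k\in\mathbb N$, an integer $L\ge1$, a real $\eta>0$ and a configuration $\bar x^*=(x^*_1,\dots,x^*_{n+k})$, $\bar y^*=(y^*_1,\dots,y^*_n)$, $\bar z^*=(z^*_1,\dots,z^*_{n+k})$, $\bar u^*=(u^*_1,\dots,u^*_n)$ of vectors of norm at most $L$ in a Euclidean space, such that $z^*_i$ and $u^*_i$ are the orthogonal projections of $x^*_i$ and $y^*_i$ on $\mathrm{span}(\bar z^*\bar u^*)$ and $\|x^*_i-z^*_i\|\ge\eta$, $\|y^*_i-u^*_i\|\ge\eta$.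 For a tuple $\bar t=(\bar x,\bar y,\bar z,\bar u)$ in a Hilbert space put $\varphi(\bar t)=\sum_{i,j}|\langle t_i,t_j\rangle-\langle t^*_i,t^*_j\rangle|$. For $\varepsilon>0$, a number $\rho\in(0,1]$ is *admissible* if every tuple $\bar t$ with $\varphi(\bar t)<\rho$ satisfies, with $P$ the orthogonal projection on $\mathrm{span}(\bar z\bar u)$: $\|Px_i-z_i\|<\varepsilon$, $\|Py_i-u_i\|<\varepsilon$, $\big|\|t_i-t_j\|-\|t^*_i-t^*_j\|\big|<\varepsilon$, $\|x_i-Px_i\|\ge\eta/2$ and $\|y_i-Py_i\|\ge\eta/2$, for all indices. *The theory $T_N$.* Let $T_N$ be $T_0$ together with the statement that $H$ has infinite dimension and, for every locus, every rational $\varepsilon\in(0,1)$ and every admissible $\rho$, the following axiom, in which $\delta=2\sqrt{\varepsilon(L+2)}$, all variables range over the ball of radius $L+1$ except $w$, which ranges over the ball of radius $L+2$. For all $\bar z,\bar u$: **if** there are $\bar x,\bar y$ with - $\varphi(\bar x,\bar y,\bar z,\bar u)<\rho$; - $\sup_w\big(d_N(w)^2-\|w-u_i\|^2-\|y_i-u_i\|^2-\varepsilon^2\big)<0$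 for $i\le n$; - $\|x_i-y_j\|^2>\|x_i-z_i\|^2+d_N(z_i)^2+\varepsilon^2$ for $i>n$, $j\le n$; - $\|x_i-y_j\|>\|x_i-y_i\|-\varepsilon$ for $i\ne j$, $i,j\le n$; - $\|x_i-z_i\|^2+d_N(z_i)^2>\|x_i-y_i\|^2-\varepsilon^2$ for $i\le n$; **then** for every $\theta>0$ there are $\bar x,\bar y$ satisfying, up to the additive error $\theta$, - $\varphi(\bar x,\bar y,\bar z,\bar u)\le\rho$; - $d_N(y_i)\le\delta$ and $\big|d_N(x_i)-\min\{1,\|x_i-y_i\|\}\big|\le2\delta$ for $i\le n$; - $\big|d_N(x_i)^2-\min\{1,\|x_i-z_i\|^2+d_N(z_i)^2\}\big|\le4\delta L$ for $i>n$. **Proposition.** Let $(M,d_N)$ and $(N,d_N)$ be models of $T_N$ and let $A$ be a common subset of $M$ and $N$ (so that $M$ and $N$ induce the same inner product and the same $d_N$ on the linear span of $A$). Let $\overline{\mathrm{span}}(A)$ be the closed linear span of $A$, and suppose that $(\overline{\mathrm{span}}(A),d_N\!\upharpoonright)\models T_0$. Then $(M,d_N)\equiv_A(N,d_N)$: for every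 $L_N$-formula $\chi(v_1,\dots,v_m)$ and all $a_1,\dots,a_m\in A$, $\chi^{M}(a_1,\dots,a_m)=\chi^{N}(a_1,\dots,a_m)$. -/

import Mathlib

namespace HilbertDN

/-! ### The language `L_N` of Hilbert spaces with a unary predicate `d_N`

A structure is a real Hilbert space `H` (its sorts are the balls of integer radius around `0`)
together with a function `d : H → ℝ` interpreting `d_N`. -/

/-- Terms of the language of Hilbert spaces in the variables `x_0, …, x_{n-1}`. -/
inductive LNTerm (n : ℕ) : Type where
  | var (i : Fin n) : LNTerm n
  | zero : LNTerm n
  | plus (s t : LNTerm n) : LNTerm n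
  | scale (r : ℝ) (t : LNTerm n) : LNTerm n

/-- Formulas of continuous logic in the language `L_N` with free variables `x_0, …, x_{n-1}`:
the atomic formulas are `‖s - t‖` (the metric), `⟨s, t⟩` and `d_N(t)`, the connectives are the
continuous functions `ℝ^k → ℝ`, and `sup` and `inf` range over the ball of radius `r`
(the new variable is the last one). -/
inductive LNFormula : ℕ → Type where
  | dist {n : ℕ} (s t : LNTerm n) : LNFormula n
  | inner {n : ℕ} (s t : LNTerm n) : LNFormula n
  | pred {n : ℕ} (t : LNTerm n) : LNFormula n
  | conn {n k : ℕ} (c : C(Fin k → ℝ, ℝ)) (φ : Fin k → LNFormula n) : LNFormula n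
  | sup {n : ℕ} (r : ℕ) (φ : LNFormula (n + 1)) : LNFormula n
  | inf {n : ℕ} (r : ℕ) (φ : LNFormula (n + 1)) : LNFormula n

section Semantics

variable {H : Type*} [NormedAddCommGroup H] [InnerProductSpace ℝ H]

/-- The value of a term at the assignment `v`. -/
def LNTerm.eval {n : ℕ} (v : Fin n → H) : LNTerm n → H
  | .var i => v i
  | .zero => 0
  | .plus s t => s.eval v + t.eval v
  | .scale r t => r • t.eval v

/-- The value of a formula in the structure `(H, d)` at the assignment `v`. -/
noncomputable def LNFormula.value (d : H → ℝ) : {n : ℕ} → LNFormula n → (Fin n → H) → ℝ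
  | _, .dist s t, v => ‖s.eval v - t.eval v‖
  | _, .inner s t, v => Inner.inner ℝ (s.eval v) (t.eval v)
  | _, .pred t, v => d (t.eval v)
  | _, .conn c φ, v => c (fun i => (φ i).value d v)
  | n, .sup r φ, v =>
      ⨆ x : Metric.closedBall (0 : H) (r : ℝ), φ.value d (Fin.snoc (α := fun _ : Fin (n + 1) => H) v x)
  | n, .inf r φ, v =>
      ⨅ x : Metric.closedBall (0 : H) (r : ℝ), φ.value d (Fin.snoc (α := fun _ : Fin (n + 1) => H) v x)

/-- `(H, d)` is a model of `T_0`: a Hilbert space with `d : H → [0,1]` satisfying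
`sup_x min {1 ∸ d(x), inf_y max {|d(x) - ‖x - y‖|, d(y)}} = 0` and
`sup_x sup_y [d(y) - ‖x - y‖ - d(x)] ≤ 0`. -/
structure IsModelT0 (d : H → ℝ) : Prop where
  complete : CompleteSpace H
  nonneg : ∀ x, 0 ≤ d x
  le_one : ∀ x, d x ≤ 1
  witness : ∀ x, d x < 1 → ∀ ε > 0, ∃ y, |d x - ‖x - y‖| < ε ∧ d y < ε
  lipschitz : ∀ x y, d y - ‖x - y‖ - d x ≤ 0

end Semantics

/-! ### The axiom scheme of `T_N` -/

/-- A Hilbert space geometric locus, given by one configuration `(x, y, z, u)` realizing it.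
The indices `i ≤ n` of the `x`'s and `z`'s are `Sum.inl i` and the indices `i > n` are `Sum.inr i`.
The points lie in the ball of radius `L`, the `z`'s and `u`'s are the orthogonal projections
of the `x`'s and `y`'s on the span of all `z`'s and `u`'s, and the
`x`'s and `y`'s are at distance at least `η` from these projections. -/
structure Locus where
  (n k m L : ℕ)
  one_le_L : 1 ≤ L
  x : Fin n ⊕ Fin k → EuclideanSpace ℝ (Fin m)
  y : Fin n → EuclideanSpace ℝ (Fin m)
  z : Fin n ⊕ Fin k → EuclideanSpace ℝ (Fin m)
  u : Fin n → EuclideanSpace ℝ (Fin m)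
  norm_x_le : ∀ i, ‖x i‖ ≤ L
  norm_y_le : ∀ i, ‖y i‖ ≤ L
  norm_z_le : ∀ i, ‖z i‖ ≤ L
  norm_u_le : ∀ i, ‖u i‖ ≤ L
  proj_x : ∀ i, ∀ w ∈ Submodule.span ℝ (Set.range z ∪ Set.range u), inner ℝ (x i - z i) w = 0
  proj_y : ∀ i, ∀ w ∈ Submodule.span ℝ (Set.range z ∪ Set.range u), inner ℝ (y i - u i) w = 0
  η : ℝ
  η_pos : 0 < η
  η_le_x : ∀ i, η ≤ ‖x i - z i‖
  η_le_y : ∀ i, η ≤ ‖y i - u i‖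

/-- The concatenation of the tuples `x, y, z, u`. -/
def concat {n k : ℕ} {H : Type*} (x : Fin n ⊕ Fin k → H) (y : Fin n → H)
    (z : Fin n ⊕ Fin k → H) (u : Fin n → H) :
    (Fin n ⊕ Fin k) ⊕ Fin n ⊕ (Fin n ⊕ Fin k) ⊕ Fin n → H :=
  Sum.elim x (Sum.elim y (Sum.elim z u))

namespace Locus

variable (φ : Locus) {H : Type*} [NormedAddCommGroup H] [InnerProductSpace ℝ H]

/-- The formula `φ(x, y, z, u)`, which vanishes exactly when all the inner products between the
entries of `x, y, z, u` have the values prescribed by the locus. -/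
noncomputable def val (x : Fin φ.n ⊕ Fin φ.k → H) (y : Fin φ.n → H)
    (z : Fin φ.n ⊕ Fin φ.k → H) (u : Fin φ.n → H) : ℝ :=
  ∑ i, ∑ j, |inner ℝ (concat x y z u i) (concat x y z u j)
    - inner ℝ (concat φ.x φ.y φ.z φ.u i) (concat φ.x φ.y φ.z φ.u j)|

/-- `ρ` is an admissible value of `f(ε)`: every tuple (in any Euclidean space, hence in any
Hilbert space) with `φ < ρ` is `ε`-close to the locus: the `z`'s and `u`'s are within `ε` of the
projections of the `x`'s and `y`'s, the mutual distances are within `ε` of the prescribed ones,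
and the `x`'s and `y`'s stay at distance at least `η / 2` from the span of the `z`'s and `u`'s. -/
def Admissible (ε ρ : ℝ) : Prop :=
  ∀ (m : ℕ) (x : Fin φ.n ⊕ Fin φ.k → EuclideanSpace ℝ (Fin m))
    (y : Fin φ.n → EuclideanSpace ℝ (Fin m))
    (z : Fin φ.n ⊕ Fin φ.k → EuclideanSpace ℝ (Fin m))
    (u : Fin φ.n → EuclideanSpace ℝ (Fin m)),
    φ.val x y z u < ρ →
      (∀ i, ‖(Submodule.span ℝ (Set.range z ∪ Set.range u)).starProjection (x i) - z i‖ < ε) ∧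
      (∀ i, ‖(Submodule.span ℝ (Set.range z ∪ Set.range u)).starProjection (y i) - u i‖ < ε) ∧
      (∀ i j, |‖concat x y z u i - concat x y z u j‖
        - ‖concat φ.x φ.y φ.z φ.u i - concat φ.x φ.y φ.z φ.u j‖| < ε) ∧
      (∀ i, φ.η / 2 ≤
        ‖x i - (Submodule.span ℝ (Set.range z ∪ Set.range u)).starProjection (x i)‖) ∧
      (∀ i, φ.η / 2 ≤
        ‖y i - (Submodule.span ℝ (Set.range z ∪ Set.range u)).starProjection (y i)‖)

/-- The number `δ = 2 √(ε (L + 2))`. -/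
noncomputable def delta (ε : ℝ) : ℝ := 2 * √(ε * (φ.L + 2))

/-- The premise of the axiom: `x, y` approximately realize the locus over `z, u`, and the
distances prescribed for them do not clash with `d`. The number `θ` says that the supremum over
`w` is negative. -/
def Premise (d : H → ℝ) (ε ρ : ℝ) (z : Fin φ.n ⊕ Fin φ.k → H) (u : Fin φ.n → H)
    (x : Fin φ.n ⊕ Fin φ.k → H) (y : Fin φ.n → H) : Prop :=
  φ.val x y z u < ρ ∧
  (∃ θ > 0, ∀ w : H, ‖w‖ ≤ φ.L + 2 → ∀ i,
    d w ^ 2 + θ ≤ ‖w - u i‖ ^ 2 + ‖y i - u i‖ ^ 2 + ε ^ 2) ∧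
  (∀ (i : Fin φ.k) (j : Fin φ.n),
    ‖x (.inr i) - z (.inr i)‖ ^ 2 + d (z (.inr i)) ^ 2 + ε ^ 2 < ‖x (.inr i) - y j‖ ^ 2) ∧
  (∀ i j : Fin φ.n, j ≠ i → ‖x (.inl i) - y i‖ - ε < ‖x (.inl i) - y j‖) ∧
  (∀ i : Fin φ.n,
    ‖x (.inl i) - y i‖ ^ 2 - ε ^ 2 < ‖x (.inl i) - z (.inl i)‖ ^ 2 + d (z (.inl i)) ^ 2)

/-- The conclusion of the axiom, up to an error `θ`: `x, y` approximately realize the locus over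
`z, u`, with the prescribed values of `d` (truncated at `1`). -/
def Conclusion (d : H → ℝ) (ε ρ θ : ℝ) (z : Fin φ.n ⊕ Fin φ.k → H) (u : Fin φ.n → H)
    (x : Fin φ.n ⊕ Fin φ.k → H) (y : Fin φ.n → H) : Prop :=
  φ.val x y z u ≤ ρ + θ ∧
  (∀ i : Fin φ.n, d (y i) ≤ φ.delta ε + θ) ∧
  (∀ i : Fin φ.n, |d (x (.inl i)) - min 1 ‖x (.inl i) - y i‖| ≤ 2 * φ.delta ε + θ) ∧
  (∀ i : Fin φ.k, |d (x (.inr i)) ^ 2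
      - min 1 (‖x (.inr i) - z (.inr i)‖ ^ 2 + d (z (.inr i)) ^ 2)|
    ≤ 4 * φ.delta ε * φ.L + θ)

/-- The axiom `ψ_{φ, ε}`, with `f(ε) = ρ`. As always in continuous logic, the
existential quantifier of the conclusion is an infimum, so that it is satisfied up to an
arbitrarily small error. -/
def Psi (d : H → ℝ) (ε ρ : ℝ) : Prop :=
  ∀ (z : Fin φ.n ⊕ Fin φ.k → H) (u : Fin φ.n → H),
    (∀ i, ‖z i‖ ≤ φ.L + 1) → (∀ i, ‖u i‖ ≤ φ.L + 1) →
    (∃ (x : Fin φ.n ⊕ Fin φ.k → H) (y : Fin φ.n → H),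
      (∀ i, ‖x i‖ ≤ φ.L + 1) ∧ (∀ i, ‖y i‖ ≤ φ.L + 1) ∧ φ.Premise d ε ρ z u x y) →
    ∀ θ > 0, ∃ (x : Fin φ.n ⊕ Fin φ.k → H) (y : Fin φ.n → H),
      (∀ i, ‖x i‖ ≤ φ.L + 1) ∧ (∀ i, ‖y i‖ ≤ φ.L + 1) ∧ φ.Conclusion d ε ρ θ z u x y

end Locus

/-- `(H, d)` is a model of `T_N`: a model of `T_0` of infinite dimension satisfying all the
axioms `ψ_{φ, ε}`. -/
structure IsModelTN {H : Type*} [NormedAddCommGroup H] [InnerProductSpace ℝ H] (d : H → ℝ) :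
    Prop extends IsModelT0 d where
  infinite_dim : ¬ FiniteDimensional ℝ H
  scheme : ∀ (φ : Locus) (ε : ℚ), 0 < ε → ε < 1 → ∀ ρ : ℝ, 0 < ρ → ρ ≤ 1 →
    φ.Admissible ε ρ → φ.Psi d ε ρ

/-- `(M, dM) ≡_A (N, dN)`, where the set `A` sits in `M` through `a` and in `N` through `b`:
every `L_N`-formula has the same value in both structures at every finite tuple from `A`. -/
def ElemEquivOver {M N A : Type*} [NormedAddCommGroup M] [InnerProductSpace ℝ M]
    [NormedAddCommGroup N] [InnerProductSpace ℝ N] (dM : M → ℝ) (dN : N → ℝ)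
    (a : A → M) (b : A → N) : Prop :=
  ∀ (n : ℕ) (φ : LNFormula n) (t : Fin n → A),
    φ.value dM (fun i => a (t i)) = φ.value dN (fun i => b (t i))

end HilbertDN

namespace HilbertDN

open Filter Topology

/-! ### Families with prescribed inner products -/

section Gram

variable {E H : Type*} [NormedAddCommGroup E] [InnerProductSpace ℝ E]
  [NormedAddCommGroup H] [InnerProductSpace ℝ H]

/-! The proof is a back-and-forth between the ultrapowers of `M` and `N` along one nonprincipal
ultrafilter on `ℕ`. By Łoś's theorem the diagonal embeddings are elementary (`value_diag`). The
ultrapowers are models of `T_N` that are countably saturated for quantifier-free conditions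
(`exists_realization`), and in them a point with `d < 1` has a black point (a zero of `d`) at
distance exactly `d` (`isRichModel_ustar`).

The partial isomorphisms match two sequences with the same Gram matrix and the same values of `d`,
whose closed ranges are subspaces that are models of `T_0`. Being a model of `T_0` is what makes
amalgamation possible. If `K` is such a subspace and `p` is the projection of `w` on it, then black
points in `K` near distance `d p` from `p` give `d w ^ 2 ≤ ‖w - p‖ ^ 2 + d p ^ 2`
(`IsT0Family.sq_le`). Hence a black point of `N` can be placed in free position over `K` in `M`
without contradicting the values of `d` already there (`IsPartialIso.sq_le_of_corr`).

For the extension step, take a finite tuple `t` of `N` together with black points `b` that compute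
`d` on it. Their projections on the closed range of `g` correspond to vectors `c` of `M`, and their
orthogonal parts are copied orthogonally to `c`, as `M` has infinite dimension. After a small
perturbation this configuration satisfies the premise of an axiom of `T_N`, whose conclusion gives
vectors of `M` with almost the right inner products and almost the right values of `d`
(`IsModelTN.exists_approx`, `IsPartialIso.exists_approx`). Saturation turns these approximations
into an exact extension (`IsPartialIso.exists_extension`), and induction on formulas finishes
(`IsPartialIso.value_eq`). The hypothesis on the closed span of `A` supplies the initial partial
isomorphism. -/

theorem norm_eq_of_inner_eq {x : E} {y : H} (h : inner ℝ x x = inner ℝ y y) : ‖x‖ = ‖y‖ := by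
  rw [real_inner_self_eq_norm_sq, real_inner_self_eq_norm_sq] at h
  exact (sq_eq_sq₀ (norm_nonneg _) (norm_nonneg _)).mp h

theorem norm_sub_eq_of_inner_eq {x x' : E} {y y' : H} (h : inner ℝ x x = inner ℝ y y)
    (h' : inner ℝ x' x' = inner ℝ y' y') (hxy : inner ℝ x x' = inner ℝ y y') :
    ‖x - x'‖ = ‖y - y'‖ := by
  refine norm_eq_of_inner_eq ?_
  rw [real_inner_sub_sub_self, real_inner_sub_sub_self, h, h', hxy]

theorem exists_euclidean_copy {ι : Type*} [Finite ι] (w : ι → E) :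
    ∃ (m : ℕ) (w' : ι → EuclideanSpace ℝ (Fin m)),
      ∀ i j, inner ℝ (w' i) (w' j) = inner ℝ (w i) (w j) := by
  have : FiniteDimensional ℝ (Submodule.span ℝ (Set.range w)) :=
    FiniteDimensional.span_of_finite ℝ (Set.finite_range w)
  let b := stdOrthonormalBasis ℝ (Submodule.span ℝ (Set.range w))
  exact ⟨_, fun i => b.repr ⟨w i, Submodule.subset_span ⟨i, rfl⟩⟩, fun i j => by
    rw [b.repr.inner_map_map]; rfl⟩

/-- The orthogonal complement of a finite-dimensional subspace is still infinite-dimensional, so it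
contains an orthonormal family on which the Euclidean coordinates of `w` can be used. -/
theorem exists_orthogonal_copy (hH : ¬ FiniteDimensional ℝ H) (V : Submodule ℝ H)
    [FiniteDimensional ℝ V] {ι : Type*} [Finite ι] (w : ι → E) :
    ∃ w' : ι → H, (∀ i j, inner ℝ (w' i) (w' j) = inner ℝ (w i) (w j)) ∧
      ∀ v ∈ V, ∀ i, inner ℝ v (w' i) = 0 := by
  obtain ⟨m, e, he⟩ := exists_euclidean_copy w
  have hV : ¬ Module.Finite ℝ Vᗮ := fun _ => hH <| by
    have : FiniteDimensional ℝ (V ⊔ Vᗮ : Submodule ℝ H) := inferInstance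
    rw [Submodule.sup_orthogonal_of_hasOrthogonalProjection] at this
    exact Module.finite_def.mpr (Module.Finite.iff_fg.mp this)
  have hrank : Cardinal.aleph0 ≤ Module.rank ℝ Vᗮ := by
    rw [← not_lt, Module.rank_lt_aleph0_iff]
    exact hV
  obtain ⟨o, ho⟩ := exists_linearIndependent_of_le_rank
    ((Cardinal.natCast_le_aleph0 (n := m)).trans hrank)
  have hon := InnerProductSpace.gramSchmidtNormed_orthonormal ho
  set q : Fin m → Vᗮ := InnerProductSpace.gramSchmidtNormed ℝ o
  refine ⟨fun i => ((∑ a, e i a • q a : Vᗮ) : H), fun i j => ?_, fun v hv i => ?_⟩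
  · rw [← he, ← Submodule.coe_inner, hon.inner_sum, PiLp.inner_apply]
    simp [mul_comm]
  · exact (Submodule.mem_orthogonal V _).mp (∑ a, e i a • q a : Vᗮ).2 v hv

theorem abs_sub_le_of_abs_sq_sub_sq_le {a b c : ℝ} (ha : 0 ≤ a) (hb : 0 ≤ b) (hc : 0 ≤ c)
    (h : |a ^ 2 - b ^ 2| ≤ c ^ 2) : |a - b| ≤ c := by
  obtain ⟨h1, h2⟩ := abs_le.mp h
  refine abs_le.mpr ⟨?_, ?_⟩
  · by_contra! hlt
    nlinarith
  · by_contra! hlt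
    nlinarith

theorem abs_norm_sub_sub_norm_sub_le {x x' : E} {y y' : H} {r c : ℝ} (hc : 0 ≤ c)
    (h : 4 * r ≤ c ^ 2) (h1 : |inner ℝ x x - inner ℝ y y| ≤ r)
    (h2 : |inner ℝ x' x' - inner ℝ y' y'| ≤ r) (h3 : |inner ℝ x x' - inner ℝ y y'| ≤ r) :
    |‖x - x'‖ - ‖y - y'‖| ≤ c := by
  refine abs_sub_le_of_abs_sq_sub_sq_le (norm_nonneg _) (norm_nonneg _) hc ?_
  rw [← real_inner_self_eq_norm_sq, ← real_inner_self_eq_norm_sq, real_inner_sub_sub_self,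
    real_inner_sub_sub_self]
  rw [abs_le] at *
  constructor <;> linarith [h1.1, h1.2, h2.1, h2.2, h3.1, h3.2]

end Gram

/-! ### Existence of admissible numbers -/

section Admissible

variable {E H : Type*} [NormedAddCommGroup E] [InnerProductSpace ℝ E]
  [NormedAddCommGroup H] [InnerProductSpace ℝ H]

/-- The coefficient map of an independent family is injective on a finite-dimensional space, hence
bounded below. The constant `K` makes independence quantitative, so that it survives perturbation of
the Gram matrix. -/
theorem exists_sum_abs_le_norm {J : Type*} [Fintype J] {v : J → E} (hv : LinearIndependent ℝ v) :
    ∃ K > 0, ∀ c : J → ℝ, ∑ j, |c j| ≤ K * ‖∑ j, c j • v j‖ := by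
  obtain ⟨K, hK0, hK⟩ := LinearMap.exists_antilipschitzWith (Fintype.linearCombination ℝ v)
    (LinearMap.ker_eq_bot.mpr (linearIndependent_iff_injective_fintypeLinearCombination.mp hv))
  refine ⟨(Fintype.card J + 1) * K, by positivity, fun c => ?_⟩
  have h1 : ‖c‖ ≤ K * ‖∑ j, c j • v j‖ := by
    simpa [Fintype.linearCombination_apply] using hK.le_mul_dist c 0
  calc ∑ j, |c j| ≤ ∑ _j : J, ‖c‖ := Finset.sum_le_sum fun j _ => norm_le_pi_norm c j
    _ = Fintype.card J * ‖c‖ := by simp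
    _ ≤ (Fintype.card J + 1) * ‖c‖ := by nlinarith [norm_nonneg c]
    _ ≤ (Fintype.card J + 1) * (K * ‖∑ j, c j • v j‖) := by gcongr
    _ = _ := by ring

/-- A vector in the span of `v` that is almost orthogonal to all `v j` is small, uniformly
for all `v` whose Gram matrix is close to that of a given independent family. -/
theorem norm_le_of_mem_span_of_abs_inner_le {J : Type*} [Fintype J] {v : J → E} {K : ℝ}
    (hK0 : 0 < K) (hK : ∀ c : J → ℝ, ∑ j, |c j| ≤ K * ‖∑ j, c j • v j‖) {v' : J → H} {ρ : ℝ}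
    (hρ0 : 0 ≤ ρ) (hρ : 2 * (ρ * K ^ 2) ≤ 1)
    (hG : ∀ i j, |inner ℝ (v' i) (v' j) - inner ℝ (v i) (v j)| ≤ ρ) {a : H}
    (ha : a ∈ Submodule.span ℝ (Set.range v')) (h : ∀ j, |inner ℝ a (v' j)| ≤ 2 * ρ) :
    ‖a‖ ≤ 4 * ρ * K := by
  obtain ⟨c, rfl⟩ := (Submodule.mem_span_range_iff_exists_fun ℝ).mp ha
  set S := ∑ j, |c j| with hS
  set a := ∑ j, c j • v' j with ha'
  have hS0 : 0 ≤ S := Finset.sum_nonneg fun _ _ => abs_nonneg _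
  have h1 : ‖∑ j, c j • v j‖ ^ 2 ≤ ‖a‖ ^ 2 + ρ * S ^ 2 := by
    rw [← real_inner_self_eq_norm_sq, ← real_inner_self_eq_norm_sq, ha', sum_inner, sum_inner,
      hS, sq, Finset.sum_mul_sum, Finset.mul_sum, ← Finset.sum_add_distrib]
    refine Finset.sum_le_sum fun i _ => ?_
    rw [inner_sum, inner_sum, Finset.mul_sum, ← Finset.sum_add_distrib]
    refine Finset.sum_le_sum fun j _ => ?_
    simp only [inner_smul_left, inner_smul_right, RCLike.conj_to_real]
    have : |c i * (c j * (inner ℝ (v' i) (v' j) - inner ℝ (v i) (v j)))| ≤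
        |c i| * (|c j| * ρ) := by
      rw [abs_mul, abs_mul]
      exact mul_le_mul_of_nonneg_left (mul_le_mul_of_nonneg_left (hG i j) (abs_nonneg _))
        (abs_nonneg _)
    nlinarith [(abs_le.mp this).1]
  -- The error `ρ * S ^ 2` costs at most half of `S ^ 2` because `ρ * K ^ 2 ≤ 1 / 2`, so it is
  -- absorbed on the left.
  have h2 : S ^ 2 ≤ (2 * K * ‖a‖) ^ 2 := by
    have h3 : S ^ 2 ≤ K ^ 2 * ‖∑ j, c j • v j‖ ^ 2 := by
      rw [← mul_pow]
      exact pow_le_pow_left₀ hS0 (hK c) 2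
    have h4 : K ^ 2 * ‖∑ j, c j • v j‖ ^ 2 ≤ K ^ 2 * (‖a‖ ^ 2 + ρ * S ^ 2) := by gcongr
    have h5 : ρ * K ^ 2 * S ^ 2 ≤ 1 / 2 * S ^ 2 := by
      apply mul_le_mul_of_nonneg_right _ (sq_nonneg _)
      linarith
    nlinarith [sq_nonneg (K * ‖a‖)]
  have h6 : S ≤ 2 * K * ‖a‖ := le_of_sq_le_sq h2 (by positivity)
  -- Pairing `a` with its own expansion bounds `‖a‖ ^ 2` linearly in `S`, hence in `‖a‖`; one factor
  -- `‖a‖` then cancels.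
  have h7 : ‖a‖ ^ 2 ≤ 2 * ρ * S := by
    rw [← real_inner_self_eq_norm_sq]
    conv_lhs => rw [ha', inner_sum]
    rw [hS, Finset.mul_sum]
    refine Finset.sum_le_sum fun j _ => ?_
    rw [inner_smul_right]
    refine (le_abs_self _).trans ?_
    rw [abs_mul, mul_comm]
    exact mul_le_mul_of_nonneg_right (h j) (abs_nonneg _)
  by_contra! hlt
  have h8 : 0 < ‖a‖ := lt_of_le_of_lt (by positivity) hlt
  have h9 : 2 * ρ * S ≤ 2 * ρ * (2 * K * ‖a‖) := by gcongr
  nlinarith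

theorem Locus.abs_inner_sub_inner_le_val (φ : Locus) (x : Fin φ.n ⊕ Fin φ.k → H) (y : Fin φ.n → H)
    (z : Fin φ.n ⊕ Fin φ.k → H) (u : Fin φ.n → H)
    (i j : (Fin φ.n ⊕ Fin φ.k) ⊕ Fin φ.n ⊕ (Fin φ.n ⊕ Fin φ.k) ⊕ Fin φ.n) :
    |inner ℝ (concat x y z u i) (concat x y z u j)
      - inner ℝ (concat φ.x φ.y φ.z φ.u i) (concat φ.x φ.y φ.z φ.u j)| ≤ φ.val x y z u := by
  refine le_trans ?_ (Finset.single_le_sum (f := fun i => ∑ j,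
    |inner ℝ (concat x y z u i) (concat x y z u j)
      - inner ℝ (concat φ.x φ.y φ.z φ.u i) (concat φ.x φ.y φ.z φ.u j)|)
    (fun i _ => Finset.sum_nonneg fun j _ => abs_nonneg _) (Finset.mem_univ i))
  exact Finset.single_le_sum (f := fun j =>
    |inner ℝ (concat x y z u i) (concat x y z u j)
      - inner ℝ (concat φ.x φ.y φ.z φ.u i) (concat φ.x φ.y φ.z φ.u j)|)
    (fun j _ => abs_nonneg _) (Finset.mem_univ j)

/-- Independence of the `z`'s and `u`'s makes the projection on their span depend stably on the Gram
matrix: the error of a projection lies in the span and is almost orthogonal to the generators, hence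
small. -/
theorem Locus.exists_admissible (φ : Locus) (hφ : LinearIndependent ℝ (Sum.elim φ.z φ.u))
    {ε r : ℝ} (hε : 0 < ε) (hr : 0 < r) : ∃ ρ, 0 < ρ ∧ ρ ≤ 1 ∧ ρ ≤ r ∧ φ.Admissible ε ρ := by
  obtain ⟨K, hK0, hK⟩ := exists_sum_abs_le_norm hφ
  -- The bound `η / 4` in `e` leaves distance `η / 2` after two errors `e`. For `ρ`, the bound `1 /
  -- (2 * K ^ 2)` permits the absorption, `e / (8 * K)` makes `4 * ρ * K < e`, and `e ^ 2 / 16`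
  -- makes distances accurate to `e / 2`.
  have hη := φ.η_pos
  set e := min ε (φ.η / 4) with he
  have he0 : 0 < e := by positivity
  have heε : e ≤ ε := min_le_left _ _
  have heη : e ≤ φ.η / 4 := min_le_right _ _
  obtain ⟨ρ, hρ0, hρ⟩ : ∃ ρ > 0, ρ < min (min 1 r) (min (1 / (2 * K ^ 2)) (min (e / (8 * K))
      (e ^ 2 / 16))) := exists_between (by positivity)
  simp only [lt_min_iff] at hρ
  obtain ⟨⟨hρ1, hρr⟩, hρK, hρe, hρe2⟩ := hρ
  refine ⟨ρ, hρ0, hρ1.le, hρr.le, fun m x y z u hval => ?_⟩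
  have hG := fun i j => (φ.abs_inner_sub_inner_le_val x y z u i j).trans hval.le
  have hspan : Submodule.span ℝ (Set.range z ∪ Set.range u) =
      Submodule.span ℝ (Set.range (Sum.elim z u)) := by rw [Set.Sum.elim_range]
  have hρK' : 2 * (ρ * K ^ 2) ≤ 1 := by
    rw [lt_div_iff₀ (by positivity)] at hρK
    linarith
  have hsmall : 4 * ρ * K < e := by
    rw [lt_div_iff₀ (by positivity)] at hρe
    linarith
  have hproj : ∀ (a b : EuclideanSpace ℝ (Fin m)),
      b ∈ Submodule.span ℝ (Set.range z ∪ Set.range u) →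
      (∀ j, |inner ℝ (a - b) (Sum.elim z u j)| ≤ 2 * ρ) →
      ‖(Submodule.span ℝ (Set.range z ∪ Set.range u)).starProjection a - b‖ < e := by
    intro a b hb hab
    refine (norm_le_of_mem_span_of_abs_inner_le hK0 hK (v' := Sum.elim z u) hρ0.le hρK'
      (fun i j => ?_) ?_ fun j => ?_).trans_lt hsmall
    · simpa [concat] using hG (.inr (.inr i)) (.inr (.inr j))
    · rw [← hspan]
      exact sub_mem (Submodule.starProjection_apply_mem _ _) hb
    · have hj : Sum.elim z u j ∈ Submodule.span ℝ (Set.range z ∪ Set.range u) := by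
        rw [hspan]; exact Submodule.subset_span ⟨j, rfl⟩
      have h0 := Submodule.starProjection_inner_eq_zero
        (K := Submodule.span ℝ (Set.range z ∪ Set.range u)) a _ hj
      have : inner ℝ ((Submodule.span ℝ (Set.range z ∪ Set.range u)).starProjection a - b)
          (Sum.elim z u j) = inner ℝ (a - b) (Sum.elim z u j) := by
        rw [inner_sub_left] at h0 ⊢
        rw [inner_sub_left]
        linarith
      rw [this]
      exact hab j
  have hdist : ∀ i j, |‖concat x y z u i - concat x y z u j‖
        - ‖concat φ.x φ.y φ.z φ.u i - concat φ.x φ.y φ.z φ.u j‖| < e := fun i j =>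
    (abs_norm_sub_sub_norm_sub_le (c := e / 2) (by positivity) (by nlinarith) (hG i i) (hG j j)
      (hG i j)).trans_lt (half_lt_self he0)
  have hmemz : ∀ i, z i ∈ Submodule.span ℝ (Set.range z ∪ Set.range u) := fun i =>
    Submodule.subset_span (.inl ⟨i, rfl⟩)
  have hmemu : ∀ i, u i ∈ Submodule.span ℝ (Set.range z ∪ Set.range u) := fun i =>
    Submodule.subset_span (.inr ⟨i, rfl⟩)
  have hstar : ∀ j, Sum.elim φ.z φ.u j ∈
      Submodule.span ℝ (Set.range φ.z ∪ Set.range φ.u) := by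
    rw [← Set.Sum.elim_range]
    exact fun j => Submodule.subset_span ⟨j, rfl⟩
  have hx : ∀ i, ‖(Submodule.span ℝ (Set.range z ∪ Set.range u)).starProjection (x i) - z i‖ < e :=
    fun i => hproj _ _ (hmemz i) fun j => by
      have h1 := abs_le.mp (hG (.inl i) (.inr (.inr j)))
      have h2 := abs_le.mp (hG (.inr (.inr (.inl i))) (.inr (.inr j)))
      have h3 := φ.proj_x i _ (hstar j)
      simp only [concat, Sum.elim_inl, Sum.elim_inr, inner_sub_left] at h1 h2 h3 ⊢
      exact abs_le.mpr ⟨by linarith, by linarith⟩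
  have hy : ∀ i, ‖(Submodule.span ℝ (Set.range z ∪ Set.range u)).starProjection (y i) - u i‖ < e :=
    fun i => hproj _ _ (hmemu i) fun j => by
      have h1 := abs_le.mp (hG (.inr (.inl i)) (.inr (.inr j)))
      have h2 := abs_le.mp (hG (.inr (.inr (.inr i))) (.inr (.inr j)))
      have h3 := φ.proj_y i _ (hstar j)
      simp only [concat, Sum.elim_inl, Sum.elim_inr, inner_sub_left] at h1 h2 h3 ⊢
      exact abs_le.mpr ⟨by linarith, by linarith⟩
  have hfar : ∀ (a b c : EuclideanSpace ℝ (Fin m)) (n : ℝ), ‖c - b‖ < e → |‖a - b‖ - n| < e →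
      φ.η ≤ n → φ.η / 2 ≤ ‖a - c‖ := by
    intro a b c n h1 h2 h3
    have := norm_sub_le_norm_sub_add_norm_sub a c b
    have := (abs_lt.mp h2).1
    linarith
  exact ⟨fun i => (hx i).trans_le heε, fun i => (hy i).trans_le heε,
    fun i j => (hdist i j).trans_le heε,
    fun i => hfar _ _ _ _ (hx i) (hdist (.inl i) (.inr (.inr (.inl i)))) (φ.η_le_x i),
    fun i => hfar _ _ _ _ (hy i) (hdist (.inr (.inl i)) (.inr (.inr (.inr i)))) (φ.η_le_y i)⟩

end Admissible

/-! ### Limits of real sequences along a nonprincipal ultrafilter -/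

/-- The limit of a real sequence along a fixed nonprincipal ultrafilter on `ℕ`. -/
noncomputable def ulim (s : ℕ → ℝ) : ℝ := limUnder (hyperfilter ℕ : Filter ℕ) s

theorem tendsto_ulim {s : ℕ → ℝ} {C : ℝ} (h : ∀ k, |s k| ≤ C) :
    Tendsto s (hyperfilter ℕ) (𝓝 (ulim s)) := by
  have hK : IsCompact (Set.Icc (-C) C) := isCompact_Icc
  obtain ⟨a, -, ha⟩ := hK.ultrafilter_le_nhds ((hyperfilter ℕ).map s)
    (le_principal_iff.mpr (Eventually.of_forall fun k => abs_le.mp (h k) :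
      ∀ᶠ k in (hyperfilter ℕ : Filter ℕ), s k ∈ Set.Icc (-C) C))
  exact tendsto_nhds_limUnder ⟨a, ha⟩

theorem ulim_eq {s : ℕ → ℝ} {a : ℝ} (h : Tendsto s (hyperfilter ℕ) (𝓝 a)) : ulim s = a :=
  h.limUnder_eq

/-- Countable saturation in the form of a diagonal argument. -/
theorem exists_tendsto_of_finitely_approximable {Θ X : Type*} [Countable Θ] [Nonempty X]
    (F : Θ → ℕ → X → ℝ)
    (h : ∀ s : Finset Θ, ∀ ε > 0, ∀ᶠ k in (hyperfilter ℕ : Filter ℕ),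
      ∃ x, ∀ θ ∈ s, |F θ k x| < ε) :
    ∃ x : ℕ → X, ∀ θ, Tendsto (fun k => F θ k (x k)) (hyperfilter ℕ) (𝓝 0) := by
  classical
  obtain ⟨e, he⟩ := Countable.exists_injective_nat Θ
  have hfin : ∀ j : ℕ, {θ : Θ | e θ ≤ j}.Finite := fun j =>
    Set.Finite.preimage he.injOn (Set.finite_Iic j)
  let good : ℕ → ℕ → X → Prop := fun j k x => ∀ θ, e θ ≤ j → |F θ k x| < 1 / ((j : ℝ) + 1)
  have hgood : ∀ j, ∀ᶠ k in (hyperfilter ℕ : Filter ℕ), ∃ x, good j k x := fun j => by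
    filter_upwards [h (hfin j).toFinset (1 / ((j : ℝ) + 1)) (by positivity)] with k ⟨x, hx⟩
    exact ⟨x, fun θ hθ => hx θ (by simpa using hθ)⟩
  -- `x k` meets the first `j` conditions up to `1 / (j + 1)` for the largest feasible `j ≤ k`. Each
  -- fixed `j` is feasible for almost all `k`, so this largest value tends to infinity along the
  -- ultrafilter.
  have hex : ∀ k, ∃ x, ∀ j ≤ k, (∃ x, good j k x) → (∀ j' ≤ k, (∃ x, good j' k x) → j' ≤ j) →
      good j k x := by
    intro k
    by_cases hk : ∃ j ≤ k, (∃ x, good j k x) ∧ (∀ j' ≤ k, (∃ x, good j' k x) → j' ≤ j)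
    · obtain ⟨j, hjk, ⟨x, hx⟩, hj⟩ := hk
      refine ⟨x, fun i hik hi hi' => ?_⟩
      rwa [le_antisymm (hj i hik hi) (hi' j hjk ⟨x, hx⟩)]
    · exact ⟨Classical.arbitrary X, fun j hj h1 h2 => (hk ⟨j, hj, h1, h2⟩).elim⟩
  choose x hx using hex
  refine ⟨x, fun θ => Metric.tendsto_nhds.mpr fun ε hε => ?_⟩
  obtain ⟨n, hn⟩ := exists_nat_one_div_lt hε
  have hlarge : ∀ᶠ k in (hyperfilter ℕ : Filter ℕ), max n (e θ) ≤ k :=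
    (Nat.hyperfilter_le_atTop) (eventually_ge_atTop _)
  filter_upwards [hgood (max n (e θ)), hlarge] with k hk hle
  let p : ℕ → Prop := fun j => ∃ x, good j k x
  have hm := Nat.findGreatest_spec (P := p) hle hk
  have hmk := Nat.findGreatest_le (P := p) k
  have hge : max n (e θ) ≤ Nat.findGreatest p k := Nat.le_findGreatest hle hk
  have := hx k _ hmk hm (fun j' hj' h' => Nat.le_findGreatest hj' h') θ
    ((le_max_right _ _).trans hge)
  rw [Real.dist_eq, sub_zero]
  refine this.trans (lt_of_le_of_lt ?_ hn)
  apply one_div_le_one_div_of_le (by positivity)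
  have : (n : ℝ) ≤ (Nat.findGreatest p k : ℕ) := by exact_mod_cast (le_max_left _ _).trans hge
  linarith

theorem IsModelT0.abs_sub_le {M : Type*} [NormedAddCommGroup M] {d : M → ℝ} (hd : IsModelT0 d)
    (x y : M) : |d x - d y| ≤ ‖x - y‖ := by
  have h1 := hd.lipschitz x y
  have h2 := hd.lipschitz y x
  rw [norm_sub_rev] at h2
  exact abs_le.mpr ⟨by linarith, by linarith⟩

/-! ### The ultrapower of an inner product space -/

section Ultrapower

variable (M : Type*) [NormedAddCommGroup M] [InnerProductSpace ℝ M]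

/-- The submodule of bounded sequences. -/
def bddSubmodule : Submodule ℝ (ℕ → M) where
  carrier := {x | ∃ C : ℝ, ∀ k, ‖x k‖ ≤ C}
  zero_mem' := ⟨0, fun k => by simp⟩
  add_mem' := by
    rintro x y ⟨C, hC⟩ ⟨D, hD⟩
    exact ⟨C + D, fun k => (norm_add_le _ _).trans (add_le_add (hC k) (hD k))⟩
  smul_mem' := by
    rintro r x ⟨C, hC⟩
    exact ⟨‖r‖ * C, fun k => by
      simpa [norm_smul] using mul_le_mul_of_nonneg_left (hC k) (norm_nonneg r)⟩

/-- The space of bounded sequences in `M`. -/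
def BddSeq : Type _ := bddSubmodule M

noncomputable instance : AddCommGroup (BddSeq M) := inferInstanceAs (AddCommGroup (bddSubmodule M))

noncomputable instance : Module ℝ (BddSeq M) := inferInstanceAs (Module ℝ (bddSubmodule M))

variable {M}

/-- The entries of a bounded sequence. -/
def BddSeq.seq (x : BddSeq M) : ℕ → M := x.1

theorem BddSeq.bdd (x : BddSeq M) : ∃ C : ℝ, ∀ k, ‖x.seq k‖ ≤ C := x.2

@[simp] theorem BddSeq.add_seq (x y : BddSeq M) (k : ℕ) : (x + y).seq k = x.seq k + y.seq k := rfl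

@[simp] theorem BddSeq.smul_seq (r : ℝ) (x : BddSeq M) (k : ℕ) : (r • x).seq k = r • x.seq k := rfl

/-- A bounded sequence as an element of `BddSeq M`. -/
def BddSeq.ofSeq (x : ℕ → M) (C : ℝ) (h : ∀ k, ‖x k‖ ≤ C) : BddSeq M := ⟨x, C, h⟩

@[simp] theorem BddSeq.ofSeq_seq (x : ℕ → M) (C : ℝ) (h : ∀ k, ‖x k‖ ≤ C) :
    (BddSeq.ofSeq x C h).seq = x := rfl

theorem BddSeq.tendsto_inner_ulim (x y : BddSeq M) :
    Tendsto (fun k => inner ℝ (x.seq k) (y.seq k)) (hyperfilter ℕ)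
      (𝓝 (ulim fun k => inner ℝ (x.seq k) (y.seq k))) := by
  obtain ⟨C, hC⟩ := x.bdd
  obtain ⟨D, hD⟩ := y.bdd
  exact tendsto_ulim (C := C * D) fun k => (abs_real_inner_le_norm _ _).trans
    (mul_le_mul (hC k) (hD k) (norm_nonneg _) ((norm_nonneg _).trans (hC k)))

noncomputable instance BddSeq.core : PreInnerProductSpace.Core ℝ (BddSeq M) where
  inner x y := ulim fun k => inner ℝ (x.seq k) (y.seq k)
  conj_inner_symm x y := by simp [real_inner_comm]
  re_inner_nonneg x := by
    simpa using ge_of_tendsto' (x.tendsto_inner_ulim x) fun k => real_inner_self_nonneg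
  add_left x y z := ulim_eq <| by
    simpa [inner_add_left] using (x.tendsto_inner_ulim z).add (y.tendsto_inner_ulim z)
  smul_left x y r := ulim_eq <| by
    simpa [inner_smul_left] using (x.tendsto_inner_ulim y).const_mul r

noncomputable instance : SeminormedAddCommGroup (BddSeq M) :=
  InnerProductSpace.Core.toSeminormedAddCommGroup (𝕜 := ℝ) (c := BddSeq.core)

noncomputable instance : InnerProductSpace ℝ (BddSeq M) := InnerProductSpace.ofCore BddSeq.core

variable (M) in
/-- The ultrapower of `M`. -/
abbrev Ultrapower : Type _ := SeparationQuotient (BddSeq M)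

/-- The class of a bounded sequence in the ultrapower. -/
noncomputable def umk (x : BddSeq M) : Ultrapower M := SeparationQuotient.mk x

theorem exists_umk (X : Ultrapower M) : ∃ x : BddSeq M, umk x = X :=
  SeparationQuotient.surjective_mk X

theorem umk_add (x y : BddSeq M) : umk (x + y) = umk x + umk y := rfl

theorem umk_sub (x y : BddSeq M) : umk (x - y) = umk x - umk y := rfl

theorem umk_smul (r : ℝ) (x : BddSeq M) : umk (r • x) = r • umk x := rfl

theorem tendsto_inner_umk (x y : BddSeq M) :
    Tendsto (fun k => inner ℝ (x.seq k) (y.seq k)) (hyperfilter ℕ)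
      (𝓝 (inner ℝ (umk x) (umk y))) :=
  x.tendsto_inner_ulim y

theorem tendsto_norm_umk (x : BddSeq M) :
    Tendsto (fun k => ‖x.seq k‖) (hyperfilter ℕ) (𝓝 ‖umk x‖) := by
  have := (tendsto_inner_umk x x).sqrt
  simpa [real_inner_self_eq_norm_sq] using this

theorem tendsto_norm_sub_umk (x y : BddSeq M) :
    Tendsto (fun k => ‖x.seq k - y.seq k‖) (hyperfilter ℕ) (𝓝 ‖umk x - umk y‖) := by
  rw [← umk_sub]
  exact tendsto_norm_umk (x - y)

/-- Almost everywhere bounded sequences define elements of the ultrapower. -/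
theorem exists_seq_eventually_eq (x : ℕ → M) (C : ℝ)
    (h : ∀ᶠ k in (hyperfilter ℕ : Filter ℕ), ‖x k‖ ≤ C) :
    ∃ y : BddSeq M, ∀ᶠ k in (hyperfilter ℕ : Filter ℕ), y.seq k = x k := by
  classical
  refine ⟨.ofSeq (fun k => if ‖x k‖ ≤ C then x k else 0) |C| fun k => ?_, ?_⟩
  · split_ifs with hk
    · exact hk.trans (le_abs_self C)
    · simp
  · filter_upwards [h] with k hk
    simp [hk]

/-- Elements of a closed ball of the ultrapower are represented by sequences in the ball. -/
theorem exists_umk_of_norm_le (X : Ultrapower M) {r : ℝ} (h : ‖X‖ ≤ r) :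
    ∃ x : BddSeq M, umk x = X ∧ ∀ k, ‖x.seq k‖ ≤ r := by
  obtain ⟨x, rfl⟩ := exists_umk X
  have hr : 0 ≤ r := (norm_nonneg _).trans h
  -- Radial truncation to the ball moves `x.seq k` by `max r ‖x.seq k‖ - r`, which tends to `0`
  -- along the ultrafilter.
  have hb : ∀ k, ‖(r / max r ‖x.seq k‖) • x.seq k‖ ≤ r := fun k => by
    rw [norm_smul, Real.norm_of_nonneg (by positivity)]
    rcases eq_or_lt_of_le hr with rfl | hr'
    · simp
    · rw [div_mul_eq_mul_div, div_le_iff₀ (by positivity)]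
      exact mul_le_mul_of_nonneg_left (le_max_right _ _) hr
  refine ⟨.ofSeq _ r hb, ?_, hb⟩
  rw [← sub_eq_zero, ← norm_eq_zero]
  refine tendsto_nhds_unique (tendsto_norm_sub_umk _ _) ?_
  have key : ∀ k, ‖(r / max r ‖x.seq k‖) • x.seq k - x.seq k‖ = max r ‖x.seq k‖ - r := fun k => by
    rcases le_total ‖x.seq k‖ r with hk | hk
    · rcases eq_or_lt_of_le hr with h0 | hr'
      · have : x.seq k = 0 := by
          rw [← norm_le_zero_iff, h0]; exact hk
        simp [this, hr]
      · simp [max_eq_left hk, hr'.ne']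
    · rw [max_eq_right hk]
      rcases eq_or_lt_of_le (norm_nonneg (x.seq k)) with h0 | h0
      · have hx0 : x.seq k = 0 := norm_eq_zero.mp h0.symm
        have : r = 0 := le_antisymm (by rwa [← h0] at hk) hr
        simp [hx0, this]
      · have : (r / ‖x.seq k‖) • x.seq k - x.seq k = (r / ‖x.seq k‖ - 1) • x.seq k := by
          rw [sub_smul, one_smul]
        rw [this, norm_smul, Real.norm_of_nonpos]
        · field_simp; ring
        · rw [sub_nonpos, div_le_one h0]; exact hk
  simp only [BddSeq.ofSeq_seq, key]
  have := ((tendsto_const_nhds (x := r)).max (tendsto_norm_umk x)).sub_const r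
  simpa [max_eq_left h] using this

/-- A limit of a fast Cauchy sequence is a point within `(1 / 2) ^ n` of the `n`-th term for all
`n`. Any finite set of these conditions is met by the term of largest index, so the diagonal
argument applies. -/
instance : CompleteSpace (Ultrapower M) := by
  refine Metric.complete_of_convergent_controlled_sequences (fun n => (1 / 2) ^ n) (by simp) ?_
  intro X hX
  choose x hx using fun n => exists_umk (X n)
  obtain ⟨y, hy⟩ := exists_tendsto_of_finitely_approximable
    (fun (n : ℕ) k (y : M) => max 0 (‖y - (x n).seq k‖ - (1 / 2) ^ n)) (by
      intro s ε hε
      set N := s.sup id with hN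
      have : ∀ n ∈ s, ∀ᶠ k in (hyperfilter ℕ : Filter ℕ),
          ‖(x N).seq k - (x n).seq k‖ < (1 / 2) ^ n := fun n hn => by
        refine (tendsto_norm_sub_umk (x N) (x n)).eventually_lt_const ?_
        rw [hx, hx, ← dist_eq_norm]
        exact hX n N n (Finset.le_sup (f := id) hn) le_rfl
      filter_upwards [(Filter.eventually_all_finset s).mpr this] with k hk
      refine ⟨(x N).seq k, fun n hn => ?_⟩
      rw [max_eq_left (by linarith [hk n hn])]
      simpa using hε)
  have hlt : ∀ n, ∀ ε > 0, ∀ᶠ k in (hyperfilter ℕ : Filter ℕ),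
      ‖y k - (x n).seq k‖ < (1 / 2) ^ n + ε := fun n ε hε => by
    filter_upwards [(hy n).eventually_lt_const hε] with k hk
    linarith [(max_lt_iff.mp hk).2]
  obtain ⟨C, hC⟩ := (x 0).bdd
  obtain ⟨z, hz⟩ := exists_seq_eventually_eq y (C + 2) (by
    filter_upwards [hlt 0 1 one_pos] with k hk
    have := norm_le_norm_add_norm_sub' (y k) ((x 0).seq k)
    norm_num at hk
    linarith [hC k])
  refine ⟨umk z, ?_⟩
  have hle : ∀ n, ‖X n - umk z‖ ≤ (1 / 2) ^ n := fun n => by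
    refine le_of_forall_pos_le_add fun ε hε => ?_
    rw [← hx n, norm_sub_rev]
    refine le_of_tendsto (tendsto_norm_sub_umk z (x n)) ?_
    filter_upwards [hlt n ε hε, hz] with k hk hzk
    rw [hzk]
    exact hk.le
  refine tendsto_iff_norm_sub_tendsto_zero.mpr (squeeze_zero (fun _ => norm_nonneg _) hle ?_)
  exact tendsto_pow_atTop_nhds_zero_of_lt_one (by norm_num) (by norm_num)

/-! ### The diagonal embedding -/

/-- The constant sequence. -/
noncomputable def BddSeq.const (x : M) : BddSeq M := .ofSeq (fun _ => x) ‖x‖ fun _ => le_rfl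

@[simp] theorem BddSeq.const_seq (x : M) (k : ℕ) : (BddSeq.const x).seq k = x := rfl

variable (M) in
/-- The diagonal embedding of a space in its ultrapower. -/
noncomputable def diag : M →ₗ[ℝ] Ultrapower M where
  toFun x := umk (.const x)
  map_add' _ _ := rfl
  map_smul' _ _ := rfl

theorem inner_diag (x y : M) : inner ℝ (diag M x) (diag M y) = inner ℝ x y :=
  tendsto_nhds_unique (tendsto_inner_umk _ _) (by simp)

theorem norm_diag (x : M) : ‖diag M x‖ = ‖x‖ :=
  tendsto_nhds_unique (tendsto_norm_umk _) (by simp)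

theorem diag_injective : Function.Injective (diag M) :=
  (injective_iff_map_eq_zero _).mpr fun x hx => by
    rw [← norm_eq_zero, ← norm_diag, hx, norm_zero]

theorem ultrapower_infinite_dim (h : ¬ FiniteDimensional ℝ M) :
    ¬ FiniteDimensional ℝ (Ultrapower M) :=
  fun _ => h (FiniteDimensional.of_injective (diag M) diag_injective)

/-! ### The predicate on the ultrapower -/

/-- The extension of a predicate to the ultrapower. -/
noncomputable def ustar (d : M → ℝ) (X : Ultrapower M) : ℝ :=
  ulim fun k => d ((exists_umk X).choose.seq k)

/-- The Lipschitz axiom makes the limit independent of the representative chosen in `ustar`. -/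
theorem tendsto_ustar {d : M → ℝ} (hd : IsModelT0 d) (x : BddSeq M) :
    Tendsto (fun k => d (x.seq k)) (hyperfilter ℕ) (𝓝 (ustar d (umk x))) := by
  have hspec := (exists_umk (umk x)).choose_spec
  set y := (exists_umk (umk x)).choose with hy
  have h1 : Tendsto (fun k => d (y.seq k)) (hyperfilter ℕ) (𝓝 (ustar d (umk x))) :=
    tendsto_ulim (C := 1) fun k => abs_le.mpr
      ⟨by linarith [hd.nonneg (y.seq k)], hd.le_one _⟩
  have h2 : Tendsto (fun k => ‖x.seq k - y.seq k‖) (hyperfilter ℕ) (𝓝 0) := by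
    simpa [hspec] using tendsto_norm_sub_umk x y
  have h3 : Tendsto (fun k => d (x.seq k) - d (y.seq k)) (hyperfilter ℕ) (𝓝 0) :=
    squeeze_zero_norm (fun k => hd.abs_sub_le _ _) h2
  simpa using h3.add h1

theorem ustar_diag {d : M → ℝ} (hd : IsModelT0 d) (x : M) : ustar d (diag M x) = d x :=
  tendsto_nhds_unique (tendsto_ustar hd (.const x)) (by simp)

end Ultrapower

/-! ### Boundedness of formulas -/

section Ball

variable {H : Type*} [NormedAddCommGroup H]

/-- `f` takes bounded values on bounded tuples. -/
def BddOnBounded {n : ℕ} (f : (Fin n → H) → ℝ) : Prop :=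
  ∀ R : ℝ, ∃ C : ℝ, ∀ v : Fin n → H, (∀ i, ‖v i‖ ≤ R) → |f v| ≤ C

theorem norm_snoc_le {n : ℕ} {v : Fin n → H} {x : H} {R : ℝ} (hv : ∀ i, ‖v i‖ ≤ R)
    (hx : ‖x‖ ≤ R) (i : Fin (n + 1)) : ‖Fin.snoc (α := fun _ : Fin (n + 1) => H) v x i‖ ≤ R := by
  refine Fin.lastCases ?_ (fun i => ?_) i
  · simpa using hx
  · simpa using hv i

instance (r : ℕ) : Nonempty (Metric.closedBall (0 : H) (r : ℝ)) := ⟨⟨0, by simp⟩⟩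

theorem BddOnBounded.exists_ball_bound {n : ℕ} {f : (Fin (n + 1) → H) → ℝ} (hf : BddOnBounded f)
    (r : ℕ) (R : ℝ) : ∃ C : ℝ, ∀ v : Fin n → H, (∀ i, ‖v i‖ ≤ R) →
      ∀ x : Metric.closedBall (0 : H) (r : ℝ),
        |f (Fin.snoc (α := fun _ : Fin (n + 1) => H) v x)| ≤ C := by
  obtain ⟨C, hC⟩ := hf (max R r)
  exact ⟨C, fun v hv x => hC _ fun i => norm_snoc_le (fun i => (hv i).trans (le_max_left _ _))
    ((mem_closedBall_zero_iff.mp x.2).trans (le_max_right _ _)) i⟩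

end Ball

section Bounded

variable {H : Type*} [NormedAddCommGroup H] [InnerProductSpace ℝ H]

theorem LNTerm.exists_norm_eval_le {n : ℕ} (t : LNTerm n) (R : ℝ) :
    ∃ C : ℝ, ∀ v : Fin n → H, (∀ i, ‖v i‖ ≤ R) → ‖t.eval v‖ ≤ C := by
  induction t with
  | var i => exact ⟨R, fun v hv => hv i⟩
  | zero => exact ⟨0, fun v _ => by simp [LNTerm.eval]⟩
  | plus s t hs ht =>
    obtain ⟨C, hC⟩ := hs
    obtain ⟨D, hD⟩ := ht
    exact ⟨C + D, fun v hv => (norm_add_le _ _).trans (add_le_add (hC v hv) (hD v hv))⟩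
  | scale r t ht =>
    obtain ⟨C, hC⟩ := ht
    exact ⟨‖r‖ * C, fun v hv => by
      rw [LNTerm.eval, norm_smul]
      exact mul_le_mul_of_nonneg_left (hC v hv) (norm_nonneg r)⟩

/-- Writing an infimum as a negated supremum lets boundedness and Łoś's theorem treat only suprema.
-/
theorem value_inf_eq (d : H → ℝ) {n : ℕ} (r : ℕ) (φ : LNFormula (n + 1)) (v : Fin n → H) :
    (LNFormula.inf r φ).value d v = - ⨆ x : Metric.closedBall (0 : H) (r : ℝ),
      -φ.value d (Fin.snoc (α := fun _ : Fin (n + 1) => H) v x) := by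
  rw [LNFormula.value, iInf, iSup, Real.sInf_def, ← Set.image_neg_eq_neg, ← Set.range_comp]
  rfl

theorem LNFormula.bddOnBounded {d : H → ℝ} (hd0 : ∀ x, 0 ≤ d x) (hd1 : ∀ x, d x ≤ 1) {n : ℕ}
    (φ : LNFormula n) : BddOnBounded (φ.value d) := by
  have hsup : ∀ {n : ℕ} (r : ℕ) (f : (Fin (n + 1) → H) → ℝ), BddOnBounded f →
      BddOnBounded fun v => ⨆ x : Metric.closedBall (0 : H) (r : ℝ),
        f (Fin.snoc (α := fun _ : Fin (n + 1) => H) v x) := fun r f hf R => by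
    obtain ⟨C, hC⟩ := hf.exists_ball_bound r R
    refine ⟨C, fun v hv => abs_le.mpr ⟨?_, ciSup_le fun x => (abs_le.mp (hC v hv x)).2⟩⟩
    exact le_ciSup_of_le ⟨C, by rintro _ ⟨x, rfl⟩; exact (abs_le.mp (hC v hv x)).2⟩
      ⟨0, by simp⟩ (abs_le.mp (hC v hv _)).1
  induction φ with
  | dist s t =>
    intro R
    obtain ⟨C, hC⟩ := s.exists_norm_eval_le (H := H) R
    obtain ⟨D, hD⟩ := t.exists_norm_eval_le (H := H) R
    exact ⟨C + D, fun v hv => by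
      rw [LNFormula.value, abs_norm]
      exact (norm_sub_le _ _).trans (add_le_add (hC v hv) (hD v hv))⟩
  | inner s t =>
    intro R
    obtain ⟨C, hC⟩ := s.exists_norm_eval_le (H := H) R
    obtain ⟨D, hD⟩ := t.exists_norm_eval_le (H := H) R
    exact ⟨C * D, fun v hv => (abs_real_inner_le_norm _ _).trans
      (mul_le_mul (hC v hv) (hD v hv) (norm_nonneg _) ((norm_nonneg _).trans (hC v hv)))⟩
  | pred t => exact fun R => ⟨1, fun v _ => abs_le.mpr ⟨by
      rw [LNFormula.value]; linarith [hd0 (t.eval v)], hd1 _⟩⟩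
  | conn c φ ih =>
    intro R
    choose C hC using fun i => ih i R
    have hK := isCompact_univ_pi fun i => isCompact_Icc (a := -C i) (b := C i)
    obtain ⟨D, hD⟩ := hK.exists_bound_of_continuousOn c.continuous.continuousOn
    exact ⟨D, fun v hv => hD _ fun i _ => abs_le.mp (hC i v hv)⟩
  | sup r φ ih => exact hsup r _ ih
  | inf r φ ih =>
    intro R
    obtain ⟨C, hC⟩ := hsup r (fun v => -φ.value d v)
      (fun R => by simpa using ih R) R
    exact ⟨C, fun v hv => by rw [value_inf_eq, abs_neg]; exact hC v hv⟩

end Bounded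

/-! ### Łoś's theorem -/

section Los

variable {M : Type*} [NormedAddCommGroup M] [InnerProductSpace ℝ M]

theorem LNTerm.exists_eval_umk {n : ℕ} (t : LNTerm n) (v : Fin n → BddSeq M) :
    ∃ x : BddSeq M, umk x = t.eval (fun i => umk (v i)) ∧
      ∀ k, x.seq k = t.eval fun i => (v i).seq k := by
  induction t with
  | var i => exact ⟨v i, rfl, fun _ => rfl⟩
  | zero => exact ⟨0, rfl, fun _ => rfl⟩
  | plus s t hs ht =>
    obtain ⟨x, hx, hx'⟩ := hs
    obtain ⟨y, hy, hy'⟩ := ht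
    exact ⟨x + y, by rw [umk_add, hx, hy, LNTerm.eval], fun k => by
      rw [BddSeq.add_seq, hx', hy', LNTerm.eval]⟩
  | scale r t ht =>
    obtain ⟨x, hx, hx'⟩ := ht
    exact ⟨r • x, by rw [umk_smul, hx, LNTerm.eval], fun k => by
      rw [BddSeq.smul_seq, hx', LNTerm.eval]⟩

theorem BddSeq.exists_common_bound {n : ℕ} (v : Fin n → BddSeq M) :
    ∃ R : ℝ, ∀ i k, ‖(v i).seq k‖ ≤ R := by
  choose C hC using fun i => (v i).bdd
  exact ⟨∑ i, |C i|, fun i k => ((hC i k).trans (le_abs_self _)).trans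
    (Finset.single_le_sum (f := fun i => |C i|) (fun _ _ => abs_nonneg _) (Finset.mem_univ i))⟩

theorem tendsto_iSup_ball {n : ℕ} (r : ℕ) {f : (Fin (n + 1) → M) → ℝ}
    {g : (Fin (n + 1) → Ultrapower M) → ℝ} (hf : BddOnBounded f)
    (h : ∀ v : Fin (n + 1) → BddSeq M, Tendsto (fun k => f fun i => (v i).seq k) (hyperfilter ℕ)
      (𝓝 (g fun i => umk (v i)))) (v : Fin n → BddSeq M) :
    Tendsto (fun k => ⨆ x : Metric.closedBall (0 : M) (r : ℝ),
        f (Fin.snoc (α := fun _ : Fin (n + 1) => M) (fun i => (v i).seq k) x)) (hyperfilter ℕ)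
      (𝓝 (⨆ X : Metric.closedBall (0 : Ultrapower M) (r : ℝ),
        g (Fin.snoc (α := fun _ : Fin (n + 1) => Ultrapower M) (fun i => umk (v i)) X))) := by
  obtain ⟨R, hR⟩ := BddSeq.exists_common_bound v
  obtain ⟨C, hC⟩ := hf.exists_ball_bound r R
  have hC' := fun k x => hC (fun i => (v i).seq k) (fun i => hR i k) x
  have hbdd : ∀ k, BddAbove (Set.range fun x : Metric.closedBall (0 : M) (r : ℝ) =>
      f (Fin.snoc (α := fun _ : Fin (n + 1) => M) (fun i => (v i).seq k) x)) := fun k =>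
    ⟨C, by rintro _ ⟨x, rfl⟩; exact (abs_le.mp (hC' k x)).2⟩
  have hlim := tendsto_ulim (C := C) (s := fun k => ⨆ x : Metric.closedBall (0 : M) (r : ℝ),
      f (Fin.snoc (α := fun _ : Fin (n + 1) => M) (fun i => (v i).seq k) x)) fun k =>
    abs_le.mpr ⟨le_ciSup_of_le (hbdd k) ⟨0, by simp⟩ (abs_le.mp (hC' k _)).1,
      ciSup_le fun x => (abs_le.mp (hC' k x)).2⟩
  have hsnoc : ∀ x : BddSeq M,
      Tendsto (fun k => f (Fin.snoc (α := fun _ : Fin (n + 1) => M) (fun i => (v i).seq k)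
        (x.seq k))) (hyperfilter ℕ)
      (𝓝 (g (Fin.snoc (α := fun _ : Fin (n + 1) => Ultrapower M) (fun i => umk (v i))
        (umk x)))) := fun x => by
    convert! h (Fin.snoc (α := fun _ : Fin (n + 1) => BddSeq M) v x) using 2
    · congr 1
      ext i
      refine Fin.lastCases ?_ (fun i => ?_) i <;> simp
    · congr 1
      ext i
      refine Fin.lastCases ?_ (fun i => ?_) i <;> simp
  have hle : ∀ X : Metric.closedBall (0 : Ultrapower M) (r : ℝ),
      g (Fin.snoc (α := fun _ : Fin (n + 1) => Ultrapower M) (fun i => umk (v i)) X) ≤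
        ulim fun k => ⨆ x : Metric.closedBall (0 : M) (r : ℝ),
          f (Fin.snoc (α := fun _ : Fin (n + 1) => M) (fun i => (v i).seq k) x) := fun X => by
    obtain ⟨x, hx, hxr⟩ := exists_umk_of_norm_le X.1 (mem_closedBall_zero_iff.mp X.2)
    rw [← hx]
    exact le_of_tendsto_of_tendsto' (hsnoc x) hlim fun k =>
      le_ciSup (hbdd k) ⟨x.seq k, mem_closedBall_zero_iff.mpr (hxr k)⟩
  convert! hlim using 2
  refine le_antisymm (ciSup_le hle) ?_
  -- Near-maximizers in the balls of `M`, with error `1 / (k + 1)`, define a point of the ball of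
  -- the ultrapower that reaches the limit of the suprema.
  choose y hy using fun k : ℕ => exists_lt_of_lt_ciSup
    (f := fun x : Metric.closedBall (0 : M) (r : ℝ) =>
      f (Fin.snoc (α := fun _ : Fin (n + 1) => M) (fun i => (v i).seq k) x))
    (sub_lt_self _ (Nat.one_div_pos_of_nat (α := ℝ) (n := k)))
  have hyr : ∀ k, ‖(y k : M)‖ ≤ r := fun k => mem_closedBall_zero_iff.mp (y k).2
  have hmem : ‖umk (BddSeq.ofSeq (fun k => (y k : M)) r hyr)‖ ≤ r :=
    le_of_tendsto' (tendsto_norm_umk _) hyr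
  refine le_ciSup_of_le ⟨_, by rintro _ ⟨X, rfl⟩; exact hle X⟩
    ⟨umk (.ofSeq (fun k => (y k : M)) r hyr), mem_closedBall_zero_iff.mpr hmem⟩ ?_
  have h0 : Tendsto (fun k : ℕ => 1 / ((k : ℝ) + 1)) (hyperfilter ℕ) (𝓝 0) :=
    tendsto_one_div_add_atTop_nhds_zero_nat.mono_left Nat.hyperfilter_le_atTop
  have := hlim.sub h0
  rw [sub_zero] at this
  exact le_of_tendsto_of_tendsto' this (hsnoc _) fun k => (hy k).le

/-- Łoś's theorem for the ultrapower. -/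
theorem tendsto_value {d : M → ℝ} (hd : IsModelT0 d) {n : ℕ} (φ : LNFormula n)
    (v : Fin n → BddSeq M) :
    Tendsto (fun k => φ.value d fun i => (v i).seq k) (hyperfilter ℕ)
      (𝓝 (φ.value (ustar d) fun i => umk (v i))) := by
  induction φ with
  | dist s t =>
    obtain ⟨x, hx, hx'⟩ := s.exists_eval_umk v
    obtain ⟨y, hy, hy'⟩ := t.exists_eval_umk v
    simpa only [LNFormula.value, ← hx, ← hy, ← hx', ← hy'] using tendsto_norm_sub_umk x y
  | inner s t =>
    obtain ⟨x, hx, hx'⟩ := s.exists_eval_umk v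
    obtain ⟨y, hy, hy'⟩ := t.exists_eval_umk v
    simpa only [LNFormula.value, ← hx, ← hy, ← hx', ← hy'] using tendsto_inner_umk x y
  | pred t =>
    obtain ⟨x, hx, hx'⟩ := t.exists_eval_umk v
    simpa only [LNFormula.value, ← hx, ← hx'] using tendsto_ustar hd x
  | conn c φ ih =>
    exact (c.continuous.tendsto _).comp (tendsto_pi_nhds.mpr fun i => ih i v)
  | sup r φ ih => exact tendsto_iSup_ball r (φ.bddOnBounded hd.nonneg hd.le_one) ih v
  | inf r φ ih =>
    simp only [value_inf_eq]
    exact (tendsto_iSup_ball r (f := fun v => -φ.value d v) (g := fun v => -φ.value (ustar d) v)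
      (fun R => by simpa using φ.bddOnBounded hd.nonneg hd.le_one R) (fun v => (ih v).neg) v).neg

/-- The diagonal embedding is elementary. -/
theorem value_diag {d : M → ℝ} (hd : IsModelT0 d) {n : ℕ} (φ : LNFormula n) (v : Fin n → M) :
    φ.value (ustar d) (fun i => diag M (v i)) = φ.value d v :=
  tendsto_nhds_unique (tendsto_value hd φ fun i => .const (v i)) (by simp)

end Los

/-! ### Models with exact witnesses -/

/-- `(H, d)` is a model of `T_N` in which the infimum in the first axiom of `T_0` is attained. -/
structure IsRichModel {H : Type*} [NormedAddCommGroup H] [InnerProductSpace ℝ H] (d : H → ℝ) :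
    Prop extends IsModelTN d where
  exact_witness : ∀ x, d x < 1 → ∃ y, ‖x - y‖ = d x ∧ d y = 0

/-! ### Transfer of the axioms to the ultrapower, and its saturation -/

section Transfer

variable {M : Type*} [NormedAddCommGroup M] [InnerProductSpace ℝ M]

theorem ustar_exact_witness {d : M → ℝ} (hd : IsModelT0 d) (X : Ultrapower M)
    (hX : ustar d X < 1) : ∃ Y, ‖X - Y‖ = ustar d X ∧ ustar d Y = 0 := by
  obtain ⟨x, rfl⟩ := exists_umk X
  have hev := (tendsto_ustar hd x).eventually_lt_const hX
  obtain ⟨y, hy⟩ := exists_tendsto_of_finitely_approximable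
    (fun (b : Bool) k (y : M) => if b then ‖x.seq k - y‖ - d (x.seq k) else d y) (by
      intro s ε hε
      filter_upwards [hev] with k hk
      obtain ⟨y, h1, h2⟩ := hd.witness _ hk ε hε
      refine ⟨y, fun b _ => ?_⟩
      cases b
      · simpa [abs_of_nonneg (hd.nonneg y)] using h2
      · simpa [abs_sub_comm] using h1)
  have hy1 := hy true
  have hy2 := hy false
  simp only [↓reduceIte, Bool.false_eq_true] at hy1 hy2
  obtain ⟨C, hC⟩ := x.bdd
  obtain ⟨z, hz⟩ := exists_seq_eventually_eq y (C + 2) (by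
    filter_upwards [hy1.eventually_lt_const one_pos] with k hk
    have := norm_le_norm_add_norm_sub (x.seq k) (y k)
    linarith [hC k, hd.le_one (x.seq k)])
  refine ⟨umk z, tendsto_nhds_unique (tendsto_norm_sub_umk x z) ?_,
    tendsto_nhds_unique (tendsto_ustar hd z) ?_⟩
  · refine (tendsto_congr' ?_).mp (by simpa using hy1.add (tendsto_ustar hd x))
    filter_upwards [hz] with k hk
    rw [hk]
  · refine (tendsto_congr' ?_).mp hy2
    filter_upwards [hz] with k hk
    rw [hk]

theorem isModelT0_ustar {d : M → ℝ} (hd : IsModelT0 d) : IsModelT0 (ustar d) where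
  complete := inferInstance
  nonneg X := by
    obtain ⟨x, rfl⟩ := exists_umk X
    exact ge_of_tendsto' (tendsto_ustar hd x) fun k => hd.nonneg _
  le_one X := by
    obtain ⟨x, rfl⟩ := exists_umk X
    exact le_of_tendsto' (tendsto_ustar hd x) fun k => hd.le_one _
  witness X hX ε hε := by
    obtain ⟨Y, h1, h2⟩ := ustar_exact_witness hd X hX
    exact ⟨Y, by simpa [h1] using hε, by simpa [h2] using hε⟩
  lipschitz X Y := by
    obtain ⟨x, rfl⟩ := exists_umk X
    obtain ⟨y, rfl⟩ := exists_umk Y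
    exact le_of_tendsto' (((tendsto_ustar hd y).sub (tendsto_norm_sub_umk x y)).sub
      (tendsto_ustar hd x)) fun k => hd.lipschitz _ _

theorem tendsto_val (φ : Locus) (x : Fin φ.n ⊕ Fin φ.k → BddSeq M) (y : Fin φ.n → BddSeq M)
    (z : Fin φ.n ⊕ Fin φ.k → BddSeq M) (u : Fin φ.n → BddSeq M) :
    Tendsto (fun k => φ.val (fun i => (x i).seq k) (fun i => (y i).seq k)
      (fun i => (z i).seq k) (fun i => (u i).seq k)) (hyperfilter ℕ)
      (𝓝 (φ.val (fun i => umk (x i)) (fun i => umk (y i)) (fun i => umk (z i))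
        (fun i => umk (u i)))) := by
  refine tendsto_finsetSum _ fun i _ => tendsto_finsetSum _ fun j _ => ?_
  refine (Tendsto.sub_const ?_ _).abs
  have h1 : ∀ i k, concat (fun i => (x i).seq k) (fun i => (y i).seq k)
      (fun i => (z i).seq k) (fun i => (u i).seq k) i = (concat x y z u i).seq k := by
    rintro (i | i | i | i) k <;> rfl
  have h2 : ∀ i, concat (fun i => umk (x i)) (fun i => umk (y i)) (fun i => umk (z i))
        (fun i => umk (u i)) i = umk (concat x y z u i) := by
    rintro (i | i | i | i) <;> rfl
  simp only [h1, h2]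
  exact tendsto_inner_umk _ _

theorem exists_umk_family {ι : Type*} (X : ι → Ultrapower M) {r : ℝ} (h : ∀ i, ‖X i‖ ≤ r) :
    ∃ x : ι → BddSeq M, X = (fun i => umk (x i)) ∧ ∀ i k, ‖(x i).seq k‖ ≤ r := by
  choose x hx hr using fun i => exists_umk_of_norm_le (X i) (h i)
  exact ⟨x, funext fun i => (hx i).symm, hr⟩

/-- The premise consists of strict inequalities (the supremum having the margin `θ`), so it holds at
almost every index; the conclusion consists of weak inequalities, so it passes to the limit. -/
theorem psi_ustar {d : M → ℝ} (hd : IsModelT0 d) (φ : Locus) {ε ρ : ℝ} (h : φ.Psi d ε ρ) :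
    φ.Psi (ustar d) ε ρ := by
  intro Z U hZ hU ⟨X, Y, hX, hY, hval, ⟨θ, hθ, hw⟩, h3, h4, h5⟩ θ' hθ'
  obtain ⟨z, rfl, hz⟩ := exists_umk_family Z hZ
  obtain ⟨u, rfl, hu⟩ := exists_umk_family U hU
  obtain ⟨x, rfl, hx⟩ := exists_umk_family X hX
  obtain ⟨y, rfl, hy⟩ := exists_umk_family Y hY
  have hn : ∀ a b : BddSeq M, Tendsto (fun k => ‖a.seq k - b.seq k‖ ^ 2) (hyperfilter ℕ)
      (𝓝 (‖umk a - umk b‖ ^ 2)) := fun a b => (tendsto_norm_sub_umk a b).pow 2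
  have e1 := (tendsto_val φ x y z u).eventually_lt_const hval
  have e2 : ∀ᶠ k in (hyperfilter ℕ : Filter ℕ), ∀ w : M, ‖w‖ ≤ φ.L + 2 → ∀ i,
      d w ^ 2 + θ / 2 ≤ ‖w - (u i).seq k‖ ^ 2 + ‖(y i).seq k - (u i).seq k‖ ^ 2 + ε ^ 2 := by
    by_contra hcon
    replace hcon := Ultrafilter.eventually_not.mpr hcon
    -- `w k` is a counterexample where there is one and `0` elsewhere, which keeps the sequence in
    -- the ball. The margin at its class is `θ`, so a violation of the margin `θ / 2` cannot occur
    -- at almost all indices.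
    have hbad : ∀ k, ∃ w : M, ‖w‖ ≤ φ.L + 2 ∧
        ((¬ ∀ w : M, ‖w‖ ≤ φ.L + 2 → ∀ i,
          d w ^ 2 + θ / 2 ≤ ‖w - (u i).seq k‖ ^ 2 + ‖(y i).seq k - (u i).seq k‖ ^ 2 + ε ^ 2) →
        ∃ i, ‖w - (u i).seq k‖ ^ 2 + ‖(y i).seq k - (u i).seq k‖ ^ 2 + ε ^ 2 <
          d w ^ 2 + θ / 2) := by
      intro k
      by_cases hk : ∀ w : M, ‖w‖ ≤ φ.L + 2 → ∀ i,
          d w ^ 2 + θ / 2 ≤ ‖w - (u i).seq k‖ ^ 2 + ‖(y i).seq k - (u i).seq k‖ ^ 2 + ε ^ 2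
      · exact ⟨0, by simp; positivity, fun h => (h hk).elim⟩
      · push Not at hk
        obtain ⟨w, hw, i, hi⟩ := hk
        exact ⟨w, hw, fun _ => ⟨i, hi⟩⟩
    choose w hwL hw' using hbad
    let W : BddSeq M := .ofSeq w _ hwL
    have hWL : ‖umk W‖ ≤ φ.L + 2 := le_of_tendsto' (tendsto_norm_umk W) hwL
    have hall : ∀ i, ∀ᶠ k in (hyperfilter ℕ : Filter ℕ), d (w k) ^ 2 + θ / 2 ≤
        ‖w k - (u i).seq k‖ ^ 2 + ‖(y i).seq k - (u i).seq k‖ ^ 2 + ε ^ 2 := fun i => by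
      have hlim := (((tendsto_ustar hd W).pow 2).add_const (θ / 2)).sub
        (((hn W (u i)).add (hn (y i) (u i))).add_const (ε ^ 2))
      filter_upwards [hlim.eventually_lt_const (by linarith [hw (umk W) hWL i] : _ < (0 : ℝ))]
        with k hk
      have : W.seq k = w k := rfl
      rw [this] at hk
      linarith
    obtain ⟨k, hk1, hk2⟩ := (hcon.and (eventually_all.mpr hall)).exists
    obtain ⟨i, hi⟩ := hw' k hk1
    exact absurd (hk2 i) (not_le.mpr hi)
  have e3 : ∀ᶠ k in (hyperfilter ℕ : Filter ℕ), ∀ (i : Fin φ.k) (j : Fin φ.n),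
      ‖(x (.inr i)).seq k - (z (.inr i)).seq k‖ ^ 2 + d ((z (.inr i)).seq k) ^ 2 + ε ^ 2 <
        ‖(x (.inr i)).seq k - (y j).seq k‖ ^ 2 :=
    eventually_all.mpr fun i => eventually_all.mpr fun j =>
      ((((hn _ _).add ((tendsto_ustar hd _).pow 2)).add_const _).eventually_lt (hn _ _) (h3 i j))
  have e4 : ∀ᶠ k in (hyperfilter ℕ : Filter ℕ), ∀ i j : Fin φ.n, j ≠ i →
      ‖(x (.inl i)).seq k - (y i).seq k‖ - ε < ‖(x (.inl i)).seq k - (y j).seq k‖ :=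
    eventually_all.mpr fun i => eventually_all.mpr fun j => eventually_imp_distrib_left.mpr
      fun hij => ((tendsto_norm_sub_umk _ _).sub_const _).eventually_lt
        (tendsto_norm_sub_umk _ _) (h4 i j hij)
  have e5 : ∀ᶠ k in (hyperfilter ℕ : Filter ℕ), ∀ i : Fin φ.n,
      ‖(x (.inl i)).seq k - (y i).seq k‖ ^ 2 - ε ^ 2 <
        ‖(x (.inl i)).seq k - (z (.inl i)).seq k‖ ^ 2 + d ((z (.inl i)).seq k) ^ 2 :=
    eventually_all.mpr fun i => ((hn _ _).sub_const _).eventually_lt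
      ((hn _ _).add ((tendsto_ustar hd _).pow 2)) (h5 i)
  have hprem : ∀ᶠ k in (hyperfilter ℕ : Filter ℕ),
      ∃ p : (Fin φ.n ⊕ Fin φ.k → M) × (Fin φ.n → M), (∀ i, ‖p.1 i‖ ≤ φ.L + 1) ∧
        (∀ i, ‖p.2 i‖ ≤ φ.L + 1) ∧
        φ.Conclusion d ε ρ θ' (fun i => (z i).seq k) (fun i => (u i).seq k) p.1 p.2 := by
    filter_upwards [e1, e2, e3, e4, e5] with k k1 k2 k3 k4 k5
    obtain ⟨x', y', h1, h2, h3⟩ := h _ _ (fun i => hz i k) (fun i => hu i k)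
      ⟨_, _, fun i => hx i k, fun i => hy i k, k1, ⟨θ / 2, by positivity, k2⟩, k3, k4, k5⟩ θ' hθ'
    exact ⟨(x', y'), h1, h2, h3⟩
  have hL : (0 : ℝ) ≤ φ.L + 1 := by positivity
  have htot : ∀ k, ∃ p : (Fin φ.n ⊕ Fin φ.k → M) × (Fin φ.n → M), (∀ i, ‖p.1 i‖ ≤ φ.L + 1) ∧
        (∀ i, ‖p.2 i‖ ≤ φ.L + 1) ∧
        ((∃ p : (Fin φ.n ⊕ Fin φ.k → M) × (Fin φ.n → M), (∀ i, ‖p.1 i‖ ≤ φ.L + 1) ∧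
        (∀ i, ‖p.2 i‖ ≤ φ.L + 1) ∧
        φ.Conclusion d ε ρ θ' (fun i => (z i).seq k) (fun i => (u i).seq k) p.1 p.2) →
        φ.Conclusion d ε ρ θ' (fun i => (z i).seq k) (fun i => (u i).seq k) p.1 p.2) := by
    intro k
    by_cases hk : ∃ p : (Fin φ.n ⊕ Fin φ.k → M) × (Fin φ.n → M), (∀ i, ‖p.1 i‖ ≤ φ.L + 1) ∧
        (∀ i, ‖p.2 i‖ ≤ φ.L + 1) ∧
        φ.Conclusion d ε ρ θ' (fun i => (z i).seq k) (fun i => (u i).seq k) p.1 p.2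
    · obtain ⟨p, h1, h2, h3⟩ := hk
      exact ⟨p, h1, h2, fun _ => h3⟩
    · exact ⟨0, fun _ => by simpa using hL, fun _ => by simpa using hL, fun h => (hk h).elim⟩
  choose p hp1 hp2 hp using htot
  let x' : Fin φ.n ⊕ Fin φ.k → BddSeq M := fun i => .ofSeq (fun k => (p k).1 i) _ fun k => hp1 k i
  let y' : Fin φ.n → BddSeq M := fun i => .ofSeq (fun k => (p k).2 i) _ fun k => hp2 k i
  have hconc : ∀ᶠ k in (hyperfilter ℕ : Filter ℕ), φ.Conclusion d ε ρ θ' (fun i => (z i).seq k)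
      (fun i => (u i).seq k) (fun i => (x' i).seq k) (fun i => (y' i).seq k) := by
    filter_upwards [hprem] with k hk
    exact hp k hk
  refine ⟨fun i => umk (x' i), fun i => umk (y' i),
    fun i => le_of_tendsto' (tendsto_norm_umk _) fun k => hp1 k i,
    fun i => le_of_tendsto' (tendsto_norm_umk _) fun k => hp2 k i, ?_, fun i => ?_, fun i => ?_,
    fun i => ?_⟩
  · exact le_of_tendsto (tendsto_val φ x' y' z u) (hconc.mono fun k hk => hk.1)
  · exact le_of_tendsto (tendsto_ustar hd _) (hconc.mono fun k hk => hk.2.1 i)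
  · exact le_of_tendsto ((tendsto_ustar hd _).sub
      ((tendsto_const_nhds (x := (1 : ℝ))).min (tendsto_norm_sub_umk _ _))).abs
      (hconc.mono fun k hk => hk.2.2.1 i)
  · exact le_of_tendsto (((tendsto_ustar hd _).pow 2).sub ((tendsto_const_nhds (x := (1 : ℝ))).min
      ((hn _ _).add ((tendsto_ustar hd _).pow 2)))).abs (hconc.mono fun k hk => hk.2.2.2 i)

theorem isRichModel_ustar {d : M → ℝ} (hd : IsModelTN d) : IsRichModel (ustar d) where
  toIsModelT0 := isModelT0_ustar hd.toIsModelT0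
  infinite_dim := ultrapower_infinite_dim hd.infinite_dim
  scheme φ ε h0 h1 ρ hρ hρ1 had := psi_ustar hd.toIsModelT0 φ (hd.scheme φ ε h0 h1 ρ hρ hρ1 had)
  exact_witness := ustar_exact_witness hd.toIsModelT0

/-- Countable saturation of the ultrapower for quantifier-free conditions. -/
theorem exists_realization {ι κ : Type*} [Countable ι] [Countable κ] {d : M → ℝ}
    (hd : IsModelT0 d) (f : ι → Ultrapower M) (G : κ → κ → ℝ) (F : ι → κ → ℝ) (D : κ → ℝ)
    (h : ∀ (s : Finset κ) (r : Finset ι), ∀ ε > 0, ∃ g : κ → Ultrapower M,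
      (∀ i ∈ s, ∀ j ∈ s, |inner ℝ (g i) (g j) - G i j| < ε) ∧
      (∀ i ∈ r, ∀ j ∈ s, |inner ℝ (f i) (g j) - F i j| < ε) ∧
      (∀ i ∈ s, |ustar d (g i) - D i| < ε)) :
    ∃ g : κ → Ultrapower M, (∀ i j, inner ℝ (g i) (g j) = G i j) ∧
      (∀ i j, inner ℝ (f i) (g j) = F i j) ∧ (∀ i, ustar d (g i) = D i) := by
  classical
  choose f' hf' using fun i => exists_umk (f i)
  obtain ⟨g, hg⟩ := exists_tendsto_of_finitely_approximable
    (fun (θ : (κ × κ) ⊕ (ι × κ) ⊕ κ) k (g : κ → M) =>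
      Sum.elim (fun p : κ × κ => inner ℝ (g p.1) (g p.2) - G p.1 p.2)
        (Sum.elim (fun p : ι × κ => inner ℝ ((f' p.1).seq k) (g p.2) - F p.1 p.2)
          (fun i => d (g i) - D i)) θ) (by
      intro S ε hε
      let s : Finset κ := S.biUnion fun θ =>
        Sum.elim (fun p : κ × κ => {p.1, p.2}) (Sum.elim (fun p : ι × κ => {p.2}) fun i => {i}) θ
      let r : Finset ι := S.biUnion fun θ =>
        Sum.elim (fun _ => ∅) (Sum.elim (fun p : ι × κ => {p.1}) fun _ => ∅) θ
      obtain ⟨g, h1, h2, h3⟩ := h s r ε hε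
      choose g' hg' using fun i => exists_umk (g i)
      have e : ∀ θ ∈ S, ∀ᶠ k in (hyperfilter ℕ : Filter ℕ),
          |Sum.elim (fun p : κ × κ => inner ℝ ((g' p.1).seq k) ((g' p.2).seq k) - G p.1 p.2)
            (Sum.elim (fun p : ι × κ => inner ℝ ((f' p.1).seq k) ((g' p.2).seq k) - F p.1 p.2)
              (fun i => d ((g' i).seq k) - D i)) θ| < ε := by
        rintro (⟨i, j⟩ | ⟨i, j⟩ | i) hθ
        · refine ((tendsto_inner_umk (g' i) (g' j)).sub_const _).abs.eventually_lt_const ?_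
          rw [hg', hg']
          exact h1 i (Finset.mem_biUnion.mpr ⟨_, hθ, by simp⟩) j
            (Finset.mem_biUnion.mpr ⟨_, hθ, by simp⟩)
        · refine ((tendsto_inner_umk (f' i) (g' j)).sub_const _).abs.eventually_lt_const ?_
          rw [hf', hg']
          exact h2 i (Finset.mem_biUnion.mpr ⟨_, hθ, by simp⟩) j
            (Finset.mem_biUnion.mpr ⟨_, hθ, by simp⟩)
        · refine ((tendsto_ustar hd (g' i)).sub_const _).abs.eventually_lt_const ?_
          rw [hg']
          exact h3 i (Finset.mem_biUnion.mpr ⟨_, hθ, by simp⟩)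
      filter_upwards [(Filter.eventually_all_finset S).mpr e] with k hk
      exact ⟨fun i => (g' i).seq k, hk⟩)
  have hG : ∀ i j, Tendsto (fun k => inner ℝ (g k i) (g k j)) (hyperfilter ℕ) (𝓝 (G i j)) :=
    fun i j => by simpa using (hg (.inl (i, j))).add_const (G i j)
  have hF : ∀ i j, Tendsto (fun k => inner ℝ ((f' i).seq k) (g k j)) (hyperfilter ℕ)
      (𝓝 (F i j)) := fun i j => by simpa using (hg (.inr (.inl (i, j)))).add_const (F i j)
  have hD : ∀ i, Tendsto (fun k => d (g k i)) (hyperfilter ℕ) (𝓝 (D i)) :=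
    fun i => by simpa using (hg (.inr (.inr i))).add_const (D i)
  -- The condition on `G i i` bounds the norms at almost all indices, so the sequence defines an
  -- element of the ultrapower.
  have hbdd : ∀ i, ∃ y : BddSeq M, ∀ᶠ k in (hyperfilter ℕ : Filter ℕ), y.seq k = g k i := fun i =>
    exists_seq_eventually_eq (fun k => g k i) √(G i i + 1) (by
      filter_upwards [(hG i i).eventually_lt_const (lt_add_one _)] with k hk
      rw [real_inner_self_eq_norm_sq] at hk
      exact Real.le_sqrt_of_sq_le hk.le)
  choose y hy using hbdd
  refine ⟨fun i => umk (y i), fun i j => ?_, fun i j => ?_, fun i => ?_⟩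
  · refine tendsto_nhds_unique (tendsto_inner_umk _ _) ((tendsto_congr' ?_).mp (hG i j))
    filter_upwards [hy i, hy j] with k h1 h2
    rw [h1, h2]
  · rw [← hf']
    refine tendsto_nhds_unique (tendsto_inner_umk _ _) ((tendsto_congr' ?_).mp (hF i j))
    filter_upwards [hy j] with k h1
    rw [h1]
  · refine tendsto_nhds_unique (tendsto_ustar hd _) ((tendsto_congr' ?_).mp (hD i))
    filter_upwards [hy i] with k h1
    rw [h1]

end Transfer

/-! ### Dense families in submodels and partial isomorphisms -/

/-- The closure of the range of `f` is a subspace and a model of `T_0`. -/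
structure IsT0Family {H : Type*} [NormedAddCommGroup H] [InnerProductSpace ℝ H] (d : H → ℝ)
    (f : ℕ → H) : Prop where
  comb : ∀ (i j : ℕ) (q r : ℚ), ∃ l, f l = (q : ℝ) • f i + (r : ℝ) • f j
  witness : ∀ i, d (f i) < 1 → ∀ ε > 0, ∃ j, |d (f i) - ‖f i - f j‖| < ε ∧ d (f j) < ε

/-- `f i ↦ g i` is a partial isomorphism between dense subsets of submodels. -/
structure IsPartialIso {M N : Type*} [NormedAddCommGroup M] [InnerProductSpace ℝ M]
    [NormedAddCommGroup N] [InnerProductSpace ℝ N] (dM : M → ℝ) (dN : N → ℝ) (f : ℕ → M)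
    (g : ℕ → N) : Prop where
  inner_eq : ∀ i j, inner ℝ (f i) (f j) = inner ℝ (g i) (g j)
  pred_eq : ∀ i, dM (f i) = dN (g i)
  left : IsT0Family dM f
  right : IsT0Family dN g

/-! ### Projections on submodels and black points -/

section Family

variable {H : Type*} [NormedAddCommGroup H] [InnerProductSpace ℝ H] {d : H → ℝ} {f : ℕ → H}

theorem IsT0Family.exists_submodule (hf : IsT0Family d f) :
    ∃ K : Submodule ℝ H, (K : Set H) = closure (Set.range f) :=
  ⟨{carrier := closure (Set.range f)
    zero_mem' := subset_closure (by
      obtain ⟨l, hl⟩ := hf.comb 0 0 0 0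
      exact ⟨l, by simp [hl]⟩)
    add_mem' := fun {a b} ha hb => map_mem_closure₂ continuous_add ha hb (by
      rintro _ ⟨i, rfl⟩ _ ⟨j, rfl⟩
      obtain ⟨l, hl⟩ := hf.comb i j 1 1
      exact ⟨l, by simp [hl]⟩)
    smul_mem' := fun r a ha => map_mem_closure₂ (s := Set.range ((↑) : ℚ → ℝ)) continuous_smul
      (Rat.denseRange_cast r) ha (by
      rintro _ ⟨q, rfl⟩ _ ⟨j, rfl⟩
      obtain ⟨l, hl⟩ := hf.comb j j q 0
      exact ⟨l, by simp [hl]⟩)}, rfl⟩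

theorem IsT0Family.exists_proj [CompleteSpace H] (hf : IsT0Family d f) (w : H) :
    ∃ p ∈ closure (Set.range f), ∀ v ∈ closure (Set.range f), inner ℝ (w - p) v = 0 := by
  obtain ⟨K, hK⟩ := hf.exists_submodule
  have : CompleteSpace K := by
    refine IsClosed.completeSpace_coe (hs := ?_)
    rw [hK]
    exact isClosed_closure
  refine ⟨K.starProjection w, ?_, fun v hv => ?_⟩
  · rw [← hK]
    exact K.starProjection_apply_mem w
  · rw [← hK] at hv
    exact K.starProjection_inner_eq_zero w v hv

theorem norm_sub_sq_of_orthogonal {w p b : H} (hp : inner ℝ (w - p) p = 0)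
    (hb : inner ℝ (w - p) b = 0) : ‖w - b‖ ^ 2 = ‖w - p‖ ^ 2 + ‖p - b‖ ^ 2 := by
  have : inner ℝ (w - p) (p - b) = 0 := by rw [inner_sub_right, hp, hb, sub_zero]
  have h := norm_add_sq_eq_norm_sq_add_norm_sq_of_inner_eq_zero _ _ this
  simp only [sub_add_sub_cancel] at h
  linarith [h]

theorem IsT0Family.exists_close (hd : IsModelT0 d) (hf : IsT0Family d f) {p : H}
    (hp : p ∈ closure (Set.range f)) (hp1 : d p < 1) {ε : ℝ} (hε : 0 < ε) :
    ∃ j, ‖p - f j‖ ≤ d p + ε ∧ d (f j) ≤ ε := by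
  -- Closeness below `1 - d p` guarantees `d (f i) < 1`, so that the witness property applies to `f
  -- i`.
  obtain ⟨_, ⟨i, rfl⟩, hi⟩ := Metric.mem_closure_iff.mp hp (min (ε / 3) (1 - d p))
    (lt_min (by positivity) (by linarith))
  rw [dist_eq_norm, lt_min_iff] at hi
  have h1 := (abs_le.mp (hd.abs_sub_le p (f i))).1
  obtain ⟨j, hj, hj'⟩ := hf.witness i (by linarith) (ε / 3) (by positivity)
  refine ⟨j, ?_, by linarith⟩
  have := norm_sub_le_norm_sub_add_norm_sub p (f i) (f j)
  linarith [(abs_lt.mp hj).1]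

/-- Almost black points of the family at distance about `d p` from `p` lie in the subspace, so
Pythagoras gives their distance to `w`, and `d` is 1-Lipschitz. If `d p = 1` the bound `d w ≤ 1` is
enough. -/
theorem IsT0Family.sq_le (hd : IsModelT0 d) (hf : IsT0Family d f) {w p : H}
    (hp : p ∈ closure (Set.range f)) (hw : ∀ v ∈ closure (Set.range f), inner ℝ (w - p) v = 0) :
    d w ^ 2 ≤ ‖w - p‖ ^ 2 + d p ^ 2 := by
  have hw0 := hd.nonneg w
  have hp0 := hd.nonneg p
  rcases lt_or_ge (d p) 1 with h1 | h1
  · set s := √(‖w - p‖ ^ 2 + d p ^ 2) with hs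
    have hs2 : s ^ 2 = ‖w - p‖ ^ 2 + d p ^ 2 := Real.sq_sqrt (by positivity)
    have hs0 : 0 ≤ s := Real.sqrt_nonneg _
    have hps : d p ≤ s := Real.le_sqrt_of_sq_le (by nlinarith [sq_nonneg ‖w - p‖])
    have : d w ≤ s := by
      refine le_of_forall_pos_le_add fun ε hε => ?_
      obtain ⟨j, hj, hj'⟩ := hf.exists_close hd hp h1 (half_pos hε)
      have h2 := norm_sub_sq_of_orthogonal (hw p hp) (hw (f j) (subset_closure ⟨j, rfl⟩))
      have h3 : ‖w - f j‖ ≤ s + ε / 2 := by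
        refine le_of_sq_le_sq ?_ (by positivity)
        have : ‖p - f j‖ ^ 2 ≤ (d p + ε / 2) ^ 2 := pow_le_pow_left₀ (norm_nonneg _) hj 2
        nlinarith
      linarith [(abs_le.mp (hd.abs_sub_le w (f j))).2]
    rw [← hs2]
    exact pow_le_pow_left₀ hw0 this 2
  · nlinarith [hd.le_one w, sq_nonneg ‖w - p‖]

/-- The number `σ` treats both cases at once: when `d t = 1` there need be no black point at
distance `1`, and `b = t`, `σ = 1` describes an imaginary one at height `1` in a new orthogonal
direction. -/
theorem IsRichModel.exists_black_point (hd : IsRichModel d) (t : H) :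
    ∃ (b : H) (σ : ℝ), 0 ≤ σ ∧ σ ≤ 1 ∧ ‖t - b‖ ^ 2 + σ ^ 2 = d t ^ 2 ∧
      ∀ k, d k ^ 2 ≤ ‖k - b‖ ^ 2 + σ ^ 2 := by
  rcases lt_or_ge (d t) 1 with h | h
  · obtain ⟨b, hb, hb0⟩ := hd.exact_witness t h
    refine ⟨b, 0, le_rfl, zero_le_one, by rw [hb]; ring, fun k => ?_⟩
    have := (abs_le.mp (hd.abs_sub_le k b)).2
    rw [hb0, sub_zero] at this
    have := pow_le_pow_left₀ (hd.nonneg k) this 2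
    linarith
  · refine ⟨t, 1, zero_le_one, le_rfl, by rw [le_antisymm (hd.le_one t) h]; simp, fun k => ?_⟩
    have := pow_le_pow_left₀ (hd.nonneg k) (hd.le_one k) 2
    nlinarith [sq_nonneg ‖k - t‖]

end Family

/-! ### The isometry between the completions, as a relation -/

section Corr

variable {M N : Type*} [NormedAddCommGroup M] [NormedAddCommGroup N] {dM : M → ℝ} {dN : N → ℝ}
    {f : ℕ → M} {g : ℕ → N}

/-- `x` and `y` correspond to each other in the completion of `f i ↦ g i`. -/
def Corr (f : ℕ → M) (g : ℕ → N) (x : M) (y : N) : Prop :=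
  ∃ i : ℕ → ℕ, Tendsto (fun k => f (i k)) atTop (𝓝 x) ∧ Tendsto (fun k => g (i k)) atTop (𝓝 y)

theorem Corr.symm {x : M} {y : N} (h : Corr f g x y) : Corr g f y x := by
  obtain ⟨i, h1, h2⟩ := h
  exact ⟨i, h2, h1⟩

theorem corr_self (l : ℕ) : Corr f g (f l) (g l) :=
  ⟨fun _ => l, tendsto_const_nhds, tendsto_const_nhds⟩

theorem Corr.mem_left {x : M} {y : N} (h : Corr f g x y) : x ∈ closure (Set.range f) := by
  obtain ⟨i, h1, -⟩ := h
  exact mem_closure_of_tendsto h1 (Eventually.of_forall fun k => ⟨i k, rfl⟩)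

theorem Corr.pred_eq (hM : IsModelT0 dM) (hN : IsModelT0 dN) (h : ∀ i, dM (f i) = dN (g i))
    {x : M} {y : N} (hxy : Corr f g x y) : dM x = dN y := by
  obtain ⟨i, h1, h2⟩ := hxy
  have hcM : Continuous dM := (LipschitzWith.of_dist_le_mul (K := 1) fun x y => by
    simpa [Real.dist_eq, dist_eq_norm] using hM.abs_sub_le x y).continuous
  have hcN : Continuous dN := (LipschitzWith.of_dist_le_mul (K := 1) fun x y => by
    simpa [Real.dist_eq, dist_eq_norm] using hN.abs_sub_le x y).continuous
  refine tendsto_nhds_unique ((hcM.tendsto x).comp h1) ?_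
  simpa [Function.comp_def, h] using (hcN.tendsto y).comp h2

end Corr

section PartialIso

variable {M N : Type*} [NormedAddCommGroup M] [InnerProductSpace ℝ M]
    [NormedAddCommGroup N] [InnerProductSpace ℝ N] {dM : M → ℝ} {dN : N → ℝ} {f : ℕ → M}
    {g : ℕ → N}

theorem IsPartialIso.symm (h : IsPartialIso dM dN f g) : IsPartialIso dN dM g f :=
  ⟨fun i j => (h.inner_eq i j).symm, fun i => (h.pred_eq i).symm, h.right, h.left⟩

theorem norm_sub_eq_of_gram (h : ∀ i j, inner ℝ (f i) (f j) = inner ℝ (g i) (g j)) (i j : ℕ) :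
    ‖f i - f j‖ = ‖g i - g j‖ :=
  norm_sub_eq_of_inner_eq (h i i) (h j j) (h i j)

/-- A linear relation says that a vector has norm zero, which is read off the Gram matrix. -/
theorem comb_eq_of_gram (h : ∀ i j, inner ℝ (f i) (f j) = inner ℝ (g i) (g j)) {i j l : ℕ}
    {q r : ℝ} (hl : g l = q • g i + r • g j) : f l = q • f i + r • f j := by
  refine sub_eq_zero.mp (inner_self_eq_zero (𝕜 := ℝ).mp ?_)
  have : inner ℝ (g l - (q • g i + r • g j)) (g l - (q • g i + r • g j)) = 0 := by simp [hl]
  simpa only [inner_sub_left, inner_sub_right, inner_add_left, inner_add_right,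
    inner_smul_left, inner_smul_right, h] using this

/-- Closure under combinations and witnesses is expressed by inner products and values of `d`, so it
has to be checked on one side only. -/
theorem isPartialIso_of_right (h : ∀ i j, inner ℝ (f i) (f j) = inner ℝ (g i) (g j))
    (hd : ∀ i, dM (f i) = dN (g i)) (hg : IsT0Family dN g) : IsPartialIso dM dN f g where
  inner_eq := h
  pred_eq := hd
  right := hg
  left := {
    comb := fun i j q r => by
      obtain ⟨l, hl⟩ := hg.comb i j q r
      exact ⟨l, comb_eq_of_gram h hl⟩
    witness := fun i hi ε hε => by
      rw [hd] at hi ⊢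
      obtain ⟨j, h1, h2⟩ := hg.witness i hi ε hε
      exact ⟨j, by rwa [norm_sub_eq_of_gram h], by rwa [hd]⟩ }

theorem Corr.inner_eq (h : ∀ i j, inner ℝ (f i) (f j) = inner ℝ (g i) (g j)) {x x' : M} {y y' : N}
    (hxy : Corr f g x y) (hxy' : Corr f g x' y') : inner ℝ x x' = inner ℝ y y' := by
  obtain ⟨i, h1, h2⟩ := hxy
  obtain ⟨j, h1', h2'⟩ := hxy'
  refine tendsto_nhds_unique (h1.inner h1') ?_
  simpa [h] using h2.inner (𝕜 := ℝ) h2'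

theorem Corr.norm_sub_eq (h : ∀ i j, inner ℝ (f i) (f j) = inner ℝ (g i) (g j)) {x x' : M}
    {y y' : N} (hxy : Corr f g x y) (hxy' : Corr f g x' y') : ‖x - x'‖ = ‖y - y'‖ :=
  norm_sub_eq_of_inner_eq (hxy.inner_eq h hxy) (hxy'.inner_eq h hxy') (hxy.inner_eq h hxy')

theorem exists_corr [CompleteSpace M] (h : ∀ i j, inner ℝ (f i) (f j) = inner ℝ (g i) (g j))
    {y : N} (hy : y ∈ closure (Set.range g)) : ∃ x, Corr f g x y := by
  obtain ⟨s, hs, hlim⟩ := mem_closure_iff_seq_limit.mp hy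
  choose i hi using hs
  have hc : CauchySeq fun k => f (i k) := by
    have := hlim.cauchySeq
    rw [Metric.cauchySeq_iff] at this ⊢
    simpa only [dist_eq_norm, norm_sub_eq_of_gram h, hi] using this
  obtain ⟨x, hx⟩ := cauchySeq_tendsto_of_complete hc
  exact ⟨x, i, hx, by simpa only [hi] using hlim⟩

theorem IsPartialIso.corr_smul_add_smul (h : IsPartialIso dM dN f g) {x x' : M} {y y' : N}
    (hxy : Corr f g x y) (hxy' : Corr f g x' y') (a b : ℝ) :
    Corr f g (a • x + b • x') (a • y + b • y') := by
  obtain ⟨i, h1, h2⟩ := hxy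
  obtain ⟨j, h1', h2'⟩ := hxy'
  have hq : ∀ a : ℝ, ∃ q : ℕ → ℚ, Tendsto (fun k => (q k : ℝ)) atTop (𝓝 a) := fun a => by
    obtain ⟨s, hs, hlim⟩ := mem_closure_iff_seq_limit.mp (Rat.denseRange_cast (𝕜 := ℝ) a)
    choose q hq using hs
    exact ⟨q, by simpa only [hq] using hlim⟩
  obtain ⟨q, hq1⟩ := hq a
  obtain ⟨q', hq2⟩ := hq b
  choose l hl using fun k => h.right.comb (i k) (j k) (q k) (q' k)
  refine ⟨l, ?_, ?_⟩
  · simp only [fun k => comb_eq_of_gram h.inner_eq (hl k)]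
    exact (hq1.smul h1).add (hq2.smul h1')
  · simp only [hl]
    exact (hq1.smul h2).add (hq2.smul h2')

/-- A finite tuple `s` of `N` has a copy `c + W` in `M` in free position over the range of `f`,
up to the finitely many vectors `c`. -/
theorem IsPartialIso.exists_copy [CompleteSpace M] [CompleteSpace N]
    (hM : ¬ FiniteDimensional ℝ M) (h : IsPartialIso dM dN f g) {ι : Type*} [Finite ι]
    (s : ι → N) :
    ∃ (c W : ι → M) (p : ι → N), (∀ i, Corr f g (c i) (p i)) ∧
      (∀ i, ∀ v ∈ closure (Set.range g), inner ℝ (s i - p i) v = 0) ∧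
      (∀ i j, inner ℝ (c i) (W j) = 0) ∧
      (∀ i j, inner ℝ (c i + W i) (c j + W j) = inner ℝ (s i) (s j)) ∧
      ∀ i, ‖W i‖ = ‖s i - p i‖ := by
  choose p hp hsp using fun i => h.right.exists_proj (s i)
  choose c hc using fun i => exists_corr h.inner_eq (hp i)
  have : FiniteDimensional ℝ (Submodule.span ℝ (Set.range c)) :=
    FiniteDimensional.span_of_finite ℝ (Set.finite_range c)
  obtain ⟨W, hW, hcW⟩ := exists_orthogonal_copy hM (Submodule.span ℝ (Set.range c))
    (fun i => s i - p i)
  have h0 : ∀ i j, inner ℝ (c i) (W j) = 0 := fun i j =>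
    hcW _ (Submodule.subset_span ⟨i, rfl⟩) j
  refine ⟨c, W, p, hc, hsp, h0, fun i j => ?_, fun i => norm_eq_of_inner_eq (hW i i)⟩
  have e1 : inner ℝ (W i) (c j) = 0 := by rw [real_inner_comm]; exact h0 j i
  have e2 := hsp i _ (hp j)
  have e3 : inner ℝ (p i) (s j - p j) = 0 := by rw [real_inner_comm]; exact hsp j _ (hp i)
  rw [inner_add_left, inner_add_right, inner_add_right, h0, e1, hW,
    (hc i).inner_eq h.inner_eq (hc j)]
  simp only [inner_sub_left, inner_sub_right] at e2 e3 ⊢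
  linarith

/-- A black point of `N`, or a point at distance one, can be added to `M` freely over the
range of `f`. -/
theorem IsPartialIso.sq_le_of_corr (hM : IsModelT0 dM) (hN : IsModelT0 dN)
    (h : IsPartialIso dM dN f g) {b q : N} {u : M} {σ : ℝ}
    (hb : ∀ k, dN k ^ 2 ≤ ‖k - b‖ ^ 2 + σ ^ 2) (hu : Corr f g u q)
    (hq : ∀ v ∈ closure (Set.range g), inner ℝ (b - q) v = 0) (w : M) :
    dM w ^ 2 ≤ ‖w - u‖ ^ 2 + ‖b - q‖ ^ 2 + σ ^ 2 := by
  have := hM.complete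
  have := hN.complete
  -- With `p` the projection of `w` and `k` its counterpart in `N`, the estimate is `dM w ^ 2 ≤ ‖w -
  -- p‖ ^ 2 + dN k ^ 2`, where `dN k ^ 2` is bounded by `hb` and split by Pythagoras at `q`.
  obtain ⟨p, hp, hwp⟩ := h.left.exists_proj w
  obtain ⟨k, hk⟩ := exists_corr h.symm.inner_eq hp
  have h1 := h.left.sq_le hM hp hwp
  have h2 := norm_sub_sq_of_orthogonal (hwp p hp) (hwp u hu.mem_left)
  have h3 := norm_sub_sq_of_orthogonal (hq q hu.symm.mem_left) (hq k hk.mem_left)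
  have h4 := hb k
  rw [norm_sub_rev b k] at h3
  rw [hk.symm.pred_eq hM hN h.pred_eq] at h1
  have h5 := hu.norm_sub_eq h.inner_eq hk.symm
  rw [← h5, norm_sub_rev u p] at h3
  linarith

end PartialIso

/-! ### Applying the axioms to a configuration in a model -/

section Apply

variable {M : Type*} [NormedAddCommGroup M] [InnerProductSpace ℝ M] {d : M → ℝ}

theorem linearIndependent_of_biorthogonal {J : Type*} [Finite J] {v e : J → M} {τ : ℝ}
    (hτ : τ ≠ 0) (h : ∀ i, inner ℝ (v i) (e i) = τ) (h0 : ∀ i j, i ≠ j → inner ℝ (v i) (e j) = 0) :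
    LinearIndependent ℝ v := by
  have := Fintype.ofFinite J
  refine Fintype.linearIndependent_iff.mpr fun c hc j => ?_
  have h1 : inner ℝ (∑ i, c i • v i) (e j) = c j * τ := by
    rw [sum_inner, Finset.sum_eq_single j]
    · rw [inner_smul_left, h]; rfl
    · intro i _ hij
      rw [inner_smul_left, h0 i j hij, mul_zero]
    · simp
  rw [hc, inner_zero_left] at h1
  exact (mul_eq_zero.mp h1.symm).resolve_right hτ

/-- This is the axiom scheme for a locus read off from vectors of the model itself. Their Gram data
are those of the locus, so `φ.val` is `0` on them and only the inequalities about `d` remain to be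
assumed. -/
theorem IsModelTN.exists_of_configuration (hd : IsModelTN d) {n k L : ℕ} (hL : 1 ≤ L)
    (x : Fin n ⊕ Fin k → M) (y : Fin n → M) (z : Fin n ⊕ Fin k → M) (u : Fin n → M)
    (hx : ∀ i, ‖x i‖ ≤ L) (hy : ∀ i, ‖y i‖ ≤ L) (hz : ∀ i, ‖z i‖ ≤ L) (hu : ∀ i, ‖u i‖ ≤ L)
    (hxz : ∀ i j, inner ℝ (x i - z i) (Sum.elim z u j) = 0)
    (hyu : ∀ i j, inner ℝ (y i - u i) (Sum.elim z u j) = 0)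
    {η : ℝ} (hη : 0 < η) (hηx : ∀ i, η ≤ ‖x i - z i‖) (hηy : ∀ i, η ≤ ‖y i - u i‖)
    (hli : LinearIndependent ℝ (Sum.elim z u)) {ε : ℚ} (hε0 : 0 < ε) (hε1 : ε < 1)
    {r : ℝ} (hr : 0 < r)
    (h2 : ∃ θ > 0, ∀ w : M, ‖w‖ ≤ L + 2 → ∀ i,
      d w ^ 2 + θ ≤ ‖w - u i‖ ^ 2 + ‖y i - u i‖ ^ 2 + (ε : ℝ) ^ 2)
    (h3 : ∀ (i : Fin k) (j : Fin n), ‖x (.inr i) - z (.inr i)‖ ^ 2 + d (z (.inr i)) ^ 2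
      + (ε : ℝ) ^ 2 < ‖x (.inr i) - y j‖ ^ 2)
    (h4 : ∀ i j : Fin n, j ≠ i → ‖x (.inl i) - y i‖ - ε < ‖x (.inl i) - y j‖)
    (h5 : ∀ i : Fin n, ‖x (.inl i) - y i‖ ^ 2 - (ε : ℝ) ^ 2 <
      ‖x (.inl i) - z (.inl i)‖ ^ 2 + d (z (.inl i)) ^ 2) :
    ∃ (x' : Fin n ⊕ Fin k → M) (y' : Fin n → M), (∀ i, ‖x' i‖ ≤ L + 1) ∧
      (∀ i j, |inner ℝ (concat x' y' z u i) (concat x' y' z u j) -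
        inner ℝ (concat x y z u i) (concat x y z u j)| ≤ r) ∧
      ∀ i : Fin n, |d (x' (.inl i)) - min 1 ‖x' (.inl i) - y' i‖| ≤
        2 * (2 * √(ε * (L + 2))) + r := by
  obtain ⟨m, w, hw⟩ := exists_euclidean_copy (concat x y z u)
  have hnorm : ∀ i, ‖w i‖ = ‖concat x y z u i‖ := fun i => norm_eq_of_inner_eq (hw i i)
  have hsub : ∀ i j, ‖w i - w j‖ = ‖concat x y z u i - concat x y z u j‖ := fun i j =>
    norm_sub_eq_of_inner_eq (hw i i) (hw j j) (hw i j)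
  have hperp : ∀ i i', (∀ j, inner ℝ (concat x y z u i - concat x y z u i') (Sum.elim z u j) = 0) →
      ∀ v ∈ Submodule.span ℝ (Set.range (fun i => w (.inr (.inr (.inl i)))) ∪
        Set.range (fun i => w (.inr (.inr (.inr i))))), inner ℝ (w i - w i') v = 0 := by
    intro i i' h v hv
    have hle : Submodule.span ℝ (Set.range (fun i => w (.inr (.inr (.inl i)))) ∪
        Set.range (fun i => w (.inr (.inr (.inr i))))) ≤ (ℝ ∙ (w i - w i'))ᗮ := by
      rw [Submodule.span_le]
      rintro _ (⟨j, rfl⟩ | ⟨j, rfl⟩)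
      · rw [SetLike.mem_coe, Submodule.mem_orthogonal_singleton_iff_inner_right, inner_sub_left,
          hw, hw, ← inner_sub_left]
        exact h (.inl j)
      · rw [SetLike.mem_coe, Submodule.mem_orthogonal_singleton_iff_inner_right, inner_sub_left,
          hw, hw, ← inner_sub_left]
        exact h (.inr j)
    exact Submodule.mem_orthogonal_singleton_iff_inner_right.mp (hle hv)
  let φ : Locus :=
    { n := n, k := k, m := m, L := L, one_le_L := hL
      x := fun i => w (.inl i)
      y := fun i => w (.inr (.inl i))
      z := fun i => w (.inr (.inr (.inl i)))
      u := fun i => w (.inr (.inr (.inr i)))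
      norm_x_le := fun i => (hnorm _).trans_le (hx i)
      norm_y_le := fun i => (hnorm _).trans_le (hy i)
      norm_z_le := fun i => (hnorm _).trans_le (hz i)
      norm_u_le := fun i => (hnorm _).trans_le (hu i)
      proj_x := fun i => hperp (.inl i) (.inr (.inr (.inl i))) (hxz i)
      proj_y := fun i => hperp (.inr (.inl i)) (.inr (.inr (.inr i))) (hyu i)
      η := η
      η_pos := hη
      η_le_x := fun i => (hηx i).trans_eq (hsub (.inl i) (.inr (.inr (.inl i)))).symm
      η_le_y := fun i => (hηy i).trans_eq (hsub (.inr (.inl i)) (.inr (.inr (.inr i)))).symm }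
  have hconcat : ∀ i, concat φ.x φ.y φ.z φ.u i = w i := by rintro (i | i | i | i) <;> rfl
  -- Independence is positive definiteness of the Gram matrix, which the Euclidean copy shares.
  have hφli : LinearIndependent ℝ (Sum.elim φ.z φ.u) := by
    rw [← Matrix.posDef_gram_iff_linearIndependent] at hli ⊢
    convert! hli using 1
    ext i j
    rw [Matrix.gram_apply, Matrix.gram_apply]
    have hi : ∀ i, Sum.elim φ.z φ.u i = w (.inr (.inr i)) := by rintro (i | i) <;> rfl
    rw [hi, hi, hw]
    rfl
  obtain ⟨ρ, hρ0, hρ1, hρr, had⟩ := φ.exists_admissible hφli (ε := ε) (by exact_mod_cast hε0)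
    (half_pos hr)
  have hval : φ.val x y z u < ρ := by
    have : φ.val x y z u = 0 := Finset.sum_eq_zero fun i _ => Finset.sum_eq_zero fun j _ => by
      rw [hconcat, hconcat, hw, sub_self, abs_zero]
    rwa [this]
  have hLle : ∀ a : ℝ, a ≤ L → a ≤ (L : ℝ) + 1 := fun a ha => by linarith
  obtain ⟨x', y', hx', -, hC⟩ := hd.scheme φ ε hε0 hε1 ρ hρ0 hρ1 had z u
    (fun i => hLle _ (hz i)) (fun i => hLle _ (hu i))
    ⟨x, y, fun i => hLle _ (hx i), fun i => hLle _ (hy i), hval, h2, h3, h4, h5⟩ (r / 2)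
    (half_pos hr)
  refine ⟨x', y', hx', fun i j => ?_, fun i => (hC.2.2.1 i).trans ?_⟩
  · have := φ.abs_inner_sub_inner_le_val x' y' z u i j
    rw [hconcat, hconcat, hw] at this
    exact this.trans (hC.1.trans (by linarith))
  · have : φ.delta ε = 2 * √(ε * (L + 2)) := rfl
    rw [this]
    linarith

end Apply

/-! ### Approximate extension of partial isomorphisms -/

section Perturb

theorem sq_sub_two_mul_le_norm_sub_sq {M : Type*} [NormedAddCommGroup M] {w u v : M}
    {τ R : ℝ} (hτ : 0 ≤ τ) (h : ‖w - u‖ ≤ R) (hv : ‖v‖ ≤ τ) :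
    ‖w - u‖ ^ 2 - 2 * τ * R ≤ ‖w - (u + v)‖ ^ 2 := by
  have h1 : ‖w - u‖ - τ ≤ ‖w - (u + v)‖ := by
    have := norm_sub_norm_le (w - u) v
    rw [← sub_sub]
    linarith
  have h0 := norm_nonneg (w - u)
  have h2 := norm_nonneg (w - (u + v))
  rcases le_total τ ‖w - u‖ with h3 | h3
  · nlinarith
  · nlinarith

variable {M : Type*} [NormedAddCommGroup M] [InnerProductSpace ℝ M] {d : M → ℝ}

/-- A locus needs points at positive distance from their projections, and admissibility is obtained
from independent `z`'s and `u`'s. Neither need hold here, so every vector is moved by about `τ`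
along its own new unit vector `e a i`. The axiom tolerates errors below `ε ^ 2`, so `τ` is chosen
after `ε`. All points are of the first kind (`k = 0`), each `x i` having its own black point `y i`.
-/
theorem IsModelTN.exists_approx (hd : IsModelTN d) {n : ℕ} (c u X Y : Fin n → M)
    (e : Fin 4 → Fin n → M) (σ D : Fin n → ℝ)
    (he : ∀ a i b j, inner ℝ (e a i) (e b j) = if a = b ∧ i = j then (1 : ℝ) else 0)
    (hce : ∀ a i j, inner ℝ (c i) (e a j) = 0) (hue : ∀ a i j, inner ℝ (u i) (e a j) = 0)
    (hXe : ∀ a i j, inner ℝ (X i) (e a j) = 0) (hYe : ∀ a i j, inner ℝ (Y i) (e a j) = 0)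
    (hcX : ∀ i j, inner ℝ (c i) (X j) = 0) (hcY : ∀ i j, inner ℝ (c i) (Y j) = 0)
    (huX : ∀ i j, inner ℝ (u i) (X j) = 0) (huY : ∀ i j, inner ℝ (u i) (Y j) = 0)
    (hσ0 : ∀ i, 0 ≤ σ i) (hσ1 : ∀ i, σ i ≤ 1) (hD0 : ∀ i, 0 ≤ D i) (hD1 : ∀ i, D i ≤ 1)
    (hD : ∀ i, ‖(c i + X i) - (u i + Y i)‖ ^ 2 + σ i ^ 2 = D i ^ 2)
    (hD' : ∀ i j, D i ^ 2 ≤ ‖(c i + X i) - (u j + Y j)‖ ^ 2 + σ j ^ 2)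
    (hDc : ∀ i, D i ^ 2 ≤ ‖X i‖ ^ 2 + d (c i) ^ 2)
    (hw : ∀ i w, d w ^ 2 ≤ ‖w - u i‖ ^ 2 + ‖Y i‖ ^ 2 + σ i ^ 2) {ε₀ : ℝ} (hε₀ : 0 < ε₀) :
    ∃ h : Fin n → M, (∀ i j, |inner ℝ (h i) (h j) - inner ℝ (c i + X i) (c j + X j)| < ε₀) ∧
      (∀ i, |d (h i) - D i| < ε₀) ∧
      ∀ i j, |inner ℝ (c i) (h j) - inner ℝ (c i) (c j)| < ε₀ := by
  -- choice of the parameters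
  obtain ⟨L, hL1, hL⟩ : ∃ L : ℕ, 1 ≤ L ∧ ∀ i, ‖c i‖ + ‖u i‖ + ‖X i‖ + ‖Y i‖ + 4 ≤ L := by
    obtain ⟨L, hL⟩ := exists_nat_ge (∑ i, (‖c i‖ + ‖u i‖ + ‖X i‖ + ‖Y i‖ + 4))
    refine ⟨L + 1, by omega, fun i => ?_⟩
    have := Finset.single_le_sum (f := fun i => ‖c i‖ + ‖u i‖ + ‖X i‖ + ‖Y i‖ + 4)
      (fun i _ => by positivity) (Finset.mem_univ i)
    push_cast
    linarith
  -- This makes the axiom's error `2δ = 4 * √(ε * (L + 2))` at most `ε₀ / 4`.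
  obtain ⟨ε, hε0, hε⟩ := exists_rat_btwn
    (show (0 : ℝ) < min 1 ((ε₀ / 16) ^ 2 / (L + 2)) by positivity)
  obtain ⟨hε1, hεδ⟩ := lt_min_iff.mp hε
  have hδ : √((ε : ℝ) * (L + 2)) ≤ ε₀ / 16 := by
    rw [lt_div_iff₀ (by positivity)] at hεδ
    exact Real.sqrt_le_iff.mpr ⟨by positivity, hεδ.le⟩
  obtain ⟨τ, hτ0, hτ⟩ := exists_between
    (show (0 : ℝ) < min (ε₀ / (16 * (L + 1))) ((ε : ℝ) ^ 2 / (32 * (L + 1))) by positivity)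
  obtain ⟨hτ1, hτ2⟩ := lt_min_iff.mp hτ
  rw [lt_div_iff₀ (by positivity)] at hτ1 hτ2
  have hLr : (1 : ℝ) ≤ L := by exact_mod_cast hL1
  have hτL : 0 ≤ τ * L := by positivity
  have hτε : 32 * τ < (ε : ℝ) ^ 2 := by nlinarith
  have hτ1' : τ < 1 := by nlinarith
  have hττ : τ ^ 2 ≤ τ := by nlinarith
  have hτε0 : 16 * τ < ε₀ := by nlinarith
  have hε0' : 0 < ε := by exact_mod_cast hε0
  have hε1' : ε < 1 := by exact_mod_cast hε1
  have hεε : (ε : ℝ) ^ 2 ≤ ε := by nlinarith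
  -- symmetric versions of the orthogonality relations
  have hec : ∀ a i j, inner ℝ (e a j) (c i) = 0 := fun a i j => by rw [real_inner_comm, hce]
  have heu : ∀ a i j, inner ℝ (e a j) (u i) = 0 := fun a i j => by rw [real_inner_comm, hue]
  have heX : ∀ a i j, inner ℝ (e a j) (X i) = 0 := fun a i j => by rw [real_inner_comm, hXe]
  have heY : ∀ a i j, inner ℝ (e a j) (Y i) = 0 := fun a i j => by rw [real_inner_comm, hYe]
  have hXc : ∀ i j, inner ℝ (X j) (c i) = 0 := fun i j => by rw [real_inner_comm, hcX]
  have hYc : ∀ i j, inner ℝ (Y j) (c i) = 0 := fun i j => by rw [real_inner_comm, hcY]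
  have hXu : ∀ i j, inner ℝ (X j) (u i) = 0 := fun i j => by rw [real_inner_comm, huX]
  have hYu : ∀ i j, inner ℝ (Y j) (u i) = 0 := fun i j => by rw [real_inner_comm, huY]
  have hen : ∀ a i, ‖e a i‖ = 1 := fun a i => by
    have : ‖e a i‖ ^ 2 = 1 := by rw [← real_inner_self_eq_norm_sq, he]; simp
    exact (pow_eq_one_iff_of_nonneg (norm_nonneg _) two_ne_zero).mp this
  have hτe : ∀ a i, ‖τ • e a i‖ = τ := fun a i => by
    rw [norm_smul, hen, mul_one, Real.norm_of_nonneg hτ0.le]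
  -- the perturbed configuration
  let z' : Fin n → M := fun i => c i + τ • e 0 i
  let u' : Fin n → M := fun i => u i + τ • e 1 i
  let x' : Fin n → M := fun i => z' i + (X i + τ • e 2 i)
  -- Besides the perturbation `τ`, the direction `e 3 i` carries the height `σ i`, so that `y' i`
  -- lies at distance about `D i` from `x' i`.
  let y' : Fin n → M := fun i => u' i + (Y i + (σ i + τ) • e 3 i)
  have hxz : ∀ i, x' i - z' i = X i + τ • e 2 i := fun i => add_sub_cancel_left _ _
  have hyu : ∀ i, y' i - u' i = Y i + (σ i + τ) • e 3 i := fun i => add_sub_cancel_left _ _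
  have hXn : ∀ i, ‖X i + τ • e 2 i‖ ^ 2 = ‖X i‖ ^ 2 + τ ^ 2 := fun i => by
    rw [norm_add_sq_real, inner_smul_right, hXe, hτe]; ring
  have hYn : ∀ i, ‖Y i + (σ i + τ) • e 3 i‖ ^ 2 = ‖Y i‖ ^ 2 + (σ i + τ) ^ 2 := fun i => by
    rw [norm_add_sq_real, inner_smul_right, hYe, norm_smul, hen, mul_one, Real.norm_eq_abs, sq_abs]
    ring
  have hxy : ∀ i j, ‖x' i - y' j‖ ^ 2 =
      ‖(c i + X i) - (u j + Y j)‖ ^ 2 + (3 * τ ^ 2 + (σ j + τ) ^ 2) := fun i j => by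
    have h1 : x' i - y' j = ((c i + X i) - (u j + Y j)) +
        (τ • e 0 i + τ • e 2 i - τ • e 1 j - (σ j + τ) • e 3 j) := by
      simp only [x', y', z', u']; abel
    have h2 : inner ℝ ((c i + X i) - (u j + Y j))
        (τ • e 0 i + τ • e 2 i - τ • e 1 j - (σ j + τ) • e 3 j) = 0 := by
      simp [inner_add_left, inner_sub_left, inner_add_right, inner_sub_right, inner_smul_right,
        hce, hue, hXe, hYe]
    have h3 : ‖τ • e 0 i + τ • e 2 i - τ • e 1 j - (σ j + τ) • e 3 j‖ ^ 2 =
        3 * τ ^ 2 + (σ j + τ) ^ 2 := by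
      rw [← real_inner_self_eq_norm_sq]
      simp only [inner_add_left, inner_sub_left, inner_add_right, inner_sub_right,
        inner_smul_right, inner_smul_left, he]
      simp
      ring
    rw [h1, norm_add_sq_real, h2, h3]
    ring
  have hxx : ∀ i j, |inner ℝ (x' i) (x' j) - inner ℝ (c i + X i) (c j + X j)| ≤ 2 * τ := by
    intro i j
    have : inner ℝ (x' i) (x' j) - inner ℝ (c i + X i) (c j + X j) =
        if i = j then 2 * τ ^ 2 else 0 := by
      simp [x', z', inner_add_left, inner_add_right, inner_smul_right, inner_smul_left, he, hce,
        hec, hXe, heX, hcX, hXc]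
      split_ifs <;> ring
    rw [this]
    split_ifs
    · rw [abs_of_nonneg (by positivity)]; linarith
    · simp [hτ0.le]
  have hzx : ∀ i j, |inner ℝ (z' i) (x' j) - inner ℝ (c i) (c j)| ≤ τ := by
    intro i j
    have : inner ℝ (z' i) (x' j) - inner ℝ (c i) (c j) = if i = j then τ ^ 2 else 0 := by
      simp [x', z', inner_add_left, inner_add_right, inner_smul_right, inner_smul_left, he, hce,
        hec, heX, hcX]
      split_ifs <;> ring
    rw [this]
    split_ifs
    · rw [abs_of_nonneg (by positivity)]; exact hττ
    · simp [hτ0.le]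
  have hlow : ∀ i j, D i ≤ ‖x' i - y' j‖ := fun i j => by
    refine le_of_sq_le_sq ?_ (norm_nonneg _)
    rw [hxy]
    nlinarith [hD' i j, hσ0 j]
  -- Since `σ i ≤ D i`, the excess `4 * τ ^ 2 + 2 * σ i * τ` of the square fits in `(D i + 2 * τ) ^
  -- 2`.
  have hupp : ∀ i, ‖x' i - y' i‖ ≤ D i + 2 * τ := fun i => by
    have hσD : σ i ≤ D i := le_of_sq_le_sq
      (by nlinarith [hD i, sq_nonneg ‖(c i + X i) - (u i + Y i)‖]) (hD0 i)
    refine le_of_sq_le_sq ?_ (by linarith [hD0 i])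
    rw [hxy]
    nlinarith [hD i, hD0 i]
  obtain ⟨x'', y'', hx'', hGram, hdist⟩ := hd.exists_of_configuration (n := n) (k := 0) (L := L) hL1
    (Sum.elim x' Fin.elim0) y' (Sum.elim z' Fin.elim0) u'
    (by
      rintro (i | i)
      · have h1 := norm_add_le (z' i) (X i + τ • e 2 i)
        have h2 := norm_add_le (c i) (τ • e 0 i)
        have h3 := norm_add_le (X i) (τ • e 2 i)
        rw [hτe] at h2 h3
        change ‖z' i + (X i + τ • e 2 i)‖ ≤ L
        linarith [hL i, norm_nonneg (u i), norm_nonneg (Y i)]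
      · exact i.elim0)
    (by
      intro i
      have h1 := norm_add_le (u' i) (Y i + (σ i + τ) • e 3 i)
      have h2 := norm_add_le (u i) (τ • e 1 i)
      have h3 := norm_add_le (Y i) ((σ i + τ) • e 3 i)
      rw [norm_smul, hen, mul_one, Real.norm_of_nonneg (by linarith [hσ0 i])] at h3
      rw [hτe] at h2
      change ‖u' i + (Y i + (σ i + τ) • e 3 i)‖ ≤ L
      linarith [hL i, norm_nonneg (c i), norm_nonneg (X i), hσ1 i])
    (by
      rintro (i | i)
      · have h2 := norm_add_le (c i) (τ • e 0 i)
        rw [hτe] at h2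
        change ‖c i + τ • e 0 i‖ ≤ L
        linarith [hL i, norm_nonneg (u i), norm_nonneg (Y i), norm_nonneg (X i)]
      · exact i.elim0)
    (by
      intro i
      have h2 := norm_add_le (u i) (τ • e 1 i)
      rw [hτe] at h2
      change ‖u i + τ • e 1 i‖ ≤ L
      linarith [hL i, norm_nonneg (c i), norm_nonneg (Y i), norm_nonneg (X i)])
    (by
      rintro (i | i)
      · rw [Sum.elim_inl, Sum.elim_inl, hxz]
        rintro ((j | j) | j)
        · simp [z', inner_add_left, inner_add_right, inner_smul_right, inner_smul_left, he, hec,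
            hXe, hXc]
        · exact j.elim0
        · simp [u', inner_add_left, inner_add_right, inner_smul_right, inner_smul_left, he, heu,
            hXe, hXu]
      · exact i.elim0)
    (by
      intro i
      rw [hyu]
      rintro ((j | j) | j)
      · simp [z', inner_add_left, inner_add_right, inner_smul_right, inner_smul_left, he, hec,
          hYe, hYc]
      · exact j.elim0
      · simp [u', inner_add_left, inner_add_right, inner_smul_right, inner_smul_left, he, heu,
          hYe, hYu])
    (η := τ) hτ0
    (by
      rintro (i | i)
      · rw [Sum.elim_inl, Sum.elim_inl, hxz]
        refine le_of_sq_le_sq ?_ (norm_nonneg _)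
        rw [hXn]
        nlinarith [sq_nonneg ‖X i‖]
      · exact i.elim0)
    (by
      intro i
      rw [hyu]
      refine le_of_sq_le_sq ?_ (norm_nonneg _)
      rw [hYn]
      nlinarith [sq_nonneg ‖Y i‖, hσ0 i])
    (linearIndependent_of_biorthogonal (e := Sum.elim (Sum.elim (e 0) Fin.elim0) (e 1)) hτ0.ne'
      (by
        rintro ((i | i) | i)
        · simp [z', inner_add_left, inner_smul_left, hce, hen]
        · exact i.elim0
        · simp [u', inner_add_left, inner_smul_left, hue, hen])
      (by
        rintro ((i | i) | i) ((j | j) | j) hij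
        · have hij' : i ≠ j := fun h => hij (by rw [h])
          simp [z', inner_add_left, inner_smul_left, he, hce, hij']
        · exact j.elim0
        · simp [z', inner_add_left, inner_smul_left, he, hce]
        · exact i.elim0
        · exact i.elim0
        · exact i.elim0
        · simp [u', inner_add_left, inner_smul_left, he, hue]
        · exact j.elim0
        · have hij' : i ≠ j := fun h => hij (by rw [h])
          simp [u', inner_add_left, inner_smul_left, he, hue, hij']))
    hε0' hε1' (r := min (ε₀ / 4) (ε₀ ^ 2 / 64)) (by positivity)
    (by
      -- Moving `u i` by `τ` lowers the square by at most `4 * τ * (L + 1) < ε ^ 2 / 8`, which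
      -- leaves the margin `ε ^ 2 / 2`.
      refine ⟨(ε : ℝ) ^ 2 / 2, by positivity, fun w hwL i => ?_⟩
      rw [hyu, hYn]
      have h1 : ‖w - u i‖ ≤ 2 * (L + 1) := by
        linarith [norm_sub_le w (u i), hL i, norm_nonneg (c i), norm_nonneg (Y i),
          norm_nonneg (X i)]
      have h2 := sq_sub_two_mul_le_norm_sub_sq (v := τ • e 1 i) hτ0.le h1 (hτe 1 i).le
      have h3 : (σ i) ^ 2 ≤ (σ i + τ) ^ 2 := pow_le_pow_left₀ (hσ0 i) (by linarith) 2
      change _ ≤ ‖w - (u i + τ • e 1 i)‖ ^ 2 + _ + _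
      linarith [hw i w])
    (fun i => i.elim0)
    (by
      intro i j _
      change ‖x' i - y' i‖ - ε < ‖x' i - y' j‖
      linarith [hlow i j, hupp i])
    (by
      intro i
      change ‖x' i - y' i‖ ^ 2 - _ < ‖x' i - z' i‖ ^ 2 + d (z' i) ^ 2
      rw [hxz, hXn]
      have h1 : ‖x' i - y' i‖ ^ 2 ≤ (D i + 2 * τ) ^ 2 :=
        pow_le_pow_left₀ (norm_nonneg _) (hupp i) 2
      have h2 : d (c i) - d (z' i) ≤ τ := by
        have := (abs_le.mp (hd.abs_sub_le (c i) (z' i))).2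
        rwa [norm_sub_rev, show z' i - c i = τ • e 0 i from add_sub_cancel_left _ _, hτe] at this
      have h3 : d (c i) ^ 2 ≤ d (z' i) ^ 2 + 2 * τ := by
        nlinarith [hd.nonneg (c i), hd.nonneg (z' i), hd.le_one (c i), hd.le_one (z' i)]
      nlinarith [hDc i, hD0 i, hD1 i])
  -- the estimates
  have hr1 : min (ε₀ / 4) (ε₀ ^ 2 / 64) ≤ ε₀ / 4 := min_le_left _ _
  have hr2 : min (ε₀ / 4) (ε₀ ^ 2 / 64) ≤ ε₀ ^ 2 / 64 := min_le_right _ _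
  refine ⟨fun i => x'' (.inl i), fun i j => ?_, fun i => ?_, fun i j => ?_⟩
  · have h1 : |inner ℝ (x'' (.inl i)) (x'' (.inl j)) - inner ℝ (x' i) (x' j)| ≤ _ :=
      hGram (.inl (.inl i)) (.inl (.inl j))
    have h2 := abs_sub_le (inner ℝ (x'' (.inl i)) (x'' (.inl j))) (inner ℝ (x' i) (x' j))
      (inner ℝ (c i + X i) (c j + X j))
    linarith [hxx i j]
  · have h1 : |‖x'' (.inl i) - y'' i‖ - ‖x' i - y' i‖| ≤ ε₀ / 4 :=
      abs_norm_sub_sub_norm_sub_le (by positivity) (by linarith)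
        (hGram (.inl (.inl i)) (.inl (.inl i))) (hGram (.inr (.inl i)) (.inr (.inl i)))
        (hGram (.inl (.inl i)) (.inr (.inl i)))
    have h2 : |‖x'' (.inl i) - y'' i‖ - D i| ≤ ε₀ / 4 + 2 * τ := by
      rw [abs_le] at h1 ⊢
      constructor <;> linarith [hlow i i, hupp i]
    -- The truncation at `1` is harmless because `D i ≤ 1`.
    have h3 : |min 1 ‖x'' (.inl i) - y'' i‖ - D i| ≤ ε₀ / 4 + 2 * τ := by
      have := abs_min_sub_min_le_max 1 ‖x'' (.inl i) - y'' i‖ 1 (D i)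
      rw [min_eq_right (hD1 i), sub_self, abs_zero, max_eq_right (abs_nonneg _)] at this
      exact this.trans h2
    have h4 := abs_sub_le (d (x'' (.inl i))) (min 1 ‖x'' (.inl i) - y'' i‖) (D i)
    linarith [hdist i]
  · have h1 : |inner ℝ (z' i) (x'' (.inl j)) - inner ℝ (z' i) (x' j)| ≤ _ :=
      hGram (.inr (.inr (.inl (.inl i)))) (.inl (.inl j))
    have h2 := abs_sub_le (inner ℝ (z' i) (x'' (.inl j))) (inner ℝ (z' i) (x' j))
      (inner ℝ (c i) (c j))
    have h3 : |inner ℝ (c i) (x'' (.inl j)) - inner ℝ (z' i) (x'' (.inl j))| ≤ τ * (L + 1) := by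
      rw [← inner_sub_left]
      refine (abs_real_inner_le_norm _ _).trans ?_
      rw [norm_sub_rev, show z' i - c i = τ • e 0 i from add_sub_cancel_left _ _, hτe]
      exact mul_le_mul_of_nonneg_left (hx'' _) hτ0.le
    have h4 := abs_sub_le (inner ℝ (c i) (x'' (.inl j))) (inner ℝ (z' i) (x'' (.inl j)))
      (inner ℝ (c i) (c j))
    linarith [hzx i j]

end Perturb

/-! ### Approximate realization of a tuple over a partial isomorphism -/

section Approx

variable {M N : Type*} [NormedAddCommGroup M] [InnerProductSpace ℝ M]
    [NormedAddCommGroup N] [InnerProductSpace ℝ N] {dM : M → ℝ} {dN : N → ℝ} {f : ℕ → M}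
    {g : ℕ → N}

/-- The last clause records the position relative to those `f l` whose partner `g l` occurs in `t`:
such a `g l` is its own projection, so its copy is `f l`, which up to the perturbation is one of the
parameters held fixed by the axiom. -/
theorem IsPartialIso.exists_approx (hM : IsModelTN dM) (hN : IsRichModel dN)
    (h : IsPartialIso dM dN f g) {n : ℕ} (t : Fin n → N) {ε : ℝ} (hε : 0 < ε) :
    ∃ x : Fin n → M, (∀ i j, |inner ℝ (x i) (x j) - inner ℝ (t i) (t j)| < ε) ∧
      (∀ i, |dM (x i) - dN (t i)| < ε) ∧
      ∀ i l j, t i = g l → |inner ℝ (f l) (x j) - inner ℝ (g l) (t j)| < ε := by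
  have := hM.complete
  have := hN.complete
  choose b σ hσ0 hσ1 hb hk using fun i => hN.exists_black_point (t i)
  obtain ⟨c, W, p, hc, hp, hcW, hGram, hnorm⟩ := h.exists_copy hM.infinite_dim (Sum.elim t b)
  have : FiniteDimensional ℝ (Submodule.span ℝ (Set.range c ∪ Set.range W)) :=
    FiniteDimensional.span_of_finite ℝ ((Set.finite_range c).union (Set.finite_range W))
  obtain ⟨e, he, hVe⟩ := exists_orthogonal_copy hM.infinite_dim
    (Submodule.span ℝ (Set.range c ∪ Set.range W))
    (fun i : Fin 4 × Fin n => EuclideanSpace.basisFun (Fin 4 × Fin n) ℝ i)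
  have hce : ∀ i j, inner ℝ (c i) (e j) = 0 := fun i j =>
    hVe _ (Submodule.subset_span (.inl ⟨i, rfl⟩)) j
  have hWe : ∀ i j, inner ℝ (W i) (e j) = 0 := fun i j =>
    hVe _ (Submodule.subset_span (.inr ⟨i, rfl⟩)) j
  have hdist : ∀ i j, ‖(c (.inl i) + W (.inl i)) - (c (.inr j) + W (.inr j))‖ = ‖t i - b j‖ :=
    fun i j => norm_sub_eq_of_inner_eq (hGram _ _) (hGram _ _) (hGram _ _)
  obtain ⟨x, hx1, hx2, hx3⟩ := hM.exists_approx (fun i => c (.inl i)) (fun i => c (.inr i))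
    (fun i => W (.inl i)) (fun i => W (.inr i)) (fun a i => e (a, i)) σ (fun i => dN (t i))
    (fun a i b j => by
      rw [he, orthonormal_iff_ite.mp (EuclideanSpace.basisFun (Fin 4 × Fin n) ℝ).orthonormal]
      simp)
    (fun _ _ _ => hce _ _) (fun _ _ _ => hce _ _) (fun _ _ _ => hWe _ _) (fun _ _ _ => hWe _ _)
    (fun _ _ => hcW _ _) (fun _ _ => hcW _ _) (fun _ _ => hcW _ _) (fun _ _ => hcW _ _)
    hσ0 hσ1 (fun _ => hN.nonneg _) (fun _ => hN.le_one _)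
    (fun i => by rw [hdist]; exact hb i) (fun i j => by rw [hdist]; exact hk j (t i))
    (fun i => by
      rw [hnorm, (hc _).pred_eq hM.toIsModelT0 hN.toIsModelT0 h.pred_eq]
      exact h.right.sq_le hN.toIsModelT0 (hc (.inl i)).symm.mem_left (hp (.inl i)))
    (fun i w => by
      rw [hnorm]
      exact h.sq_le_of_corr hM.toIsModelT0 hN.toIsModelT0 (hk i) (hc (.inr i)) (hp (.inr i)) w)
    hε
  refine ⟨x, fun i j => ?_, hx2, fun i l j hl => ?_⟩
  · have := hx1 i j
    rwa [hGram] at this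
  · have hgl : g l ∈ closure (Set.range g) := subset_closure ⟨l, rfl⟩
    have hpl : p (.inl i) = g l := by
      have h1 := hp (.inl i) _ (hc (.inl i)).symm.mem_left
      have h2 := hp (.inl i) _ hgl
      rw [Sum.elim_inl, hl] at h1 h2
      rw [← sub_eq_zero, ← norm_eq_zero, norm_sub_rev, norm_eq_zero,
        ← inner_self_eq_zero (𝕜 := ℝ), inner_sub_right, h1, h2, sub_zero]
    have hcl : c (.inl i) = f l := by
      have := (hc (.inl i)).norm_sub_eq h.inner_eq (corr_self (f := f) (g := g) l)
      rwa [hpl, sub_self, norm_zero, norm_eq_zero, sub_eq_zero] at this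
    have h3 := hx3 i j
    rw [hcl, (corr_self l).inner_eq h.inner_eq (hc (.inl j))] at h3
    have h4 := hp (.inl j) _ hgl
    rw [inner_sub_left, Sum.elim_inl, real_inner_comm, real_inner_comm (g l)] at h4
    rwa [sub_eq_zero.mp h4]

end Approx

/-! ### Back and forth -/

theorem exists_countable_closed {X I : Type*} [Countable I] (F : I → X → X → X) {S : Set X}
    (hS : S.Countable) :
    ∃ T : Set X, S ⊆ T ∧ T.Countable ∧ ∀ i, ∀ x ∈ T, ∀ y ∈ T, F i x y ∈ T := by
  let T : ℕ → Set X := fun n => Nat.rec S (fun _ T => T ∪ ⋃ i, Set.image2 (F i) T T) n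
  have hT : ∀ n, T (n + 1) = T n ∪ ⋃ i, Set.image2 (F i) (T n) (T n) := fun _ => rfl
  have hmono : Monotone T := monotone_nat_of_le_succ fun n => by
    rw [hT]; exact Set.subset_union_left
  have hcount : ∀ n, (T n).Countable := fun n => by
    induction n with
    | zero => exact hS
    | succ n ih =>
      rw [hT]
      exact ih.union (Set.countable_iUnion fun i => ih.image2 ih _)
  refine ⟨⋃ n, T n, Set.subset_iUnion T 0, Set.countable_iUnion hcount, fun i x hx y hy => ?_⟩
  obtain ⟨m, hm⟩ := Set.mem_iUnion.mp hx
  obtain ⟨n, hn⟩ := Set.mem_iUnion.mp hy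
  refine Set.mem_iUnion.mpr ⟨max m n + 1, ?_⟩
  rw [hT]
  exact .inr (Set.mem_iUnion.mpr ⟨i, Set.mem_image2_of_mem (hmono (le_max_left m n) hm)
    (hmono (le_max_right m n) hn)⟩)

/-- Downward Löwenheim–Skolem for models of `T_0`. -/
theorem exists_isT0Family {X H : Type*} [AddCommGroup X] [Module ℝ X] [NormedAddCommGroup H]
    [InnerProductSpace ℝ H] {d : H → ℝ} (ℓ : X →ₗ[ℝ] H)
    (hℓ : ∀ x, d (ℓ x) < 1 → ∀ ε > 0, ∃ y, |d (ℓ x) - ‖ℓ x - ℓ y‖| < ε ∧ d (ℓ y) < ε)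
    {S : Set X} (hS : S.Countable) :
    ∃ e : ℕ → X, S ⊆ Set.range e ∧ IsT0Family d fun i => ℓ (e i) := by
  have hw : ∀ (x : X) (m : ℕ), ∃ y, d (ℓ x) < 1 →
      |d (ℓ x) - ‖ℓ x - ℓ y‖| < 1 / ((m : ℝ) + 1) ∧ d (ℓ y) < 1 / ((m : ℝ) + 1) := fun x m => by
    by_cases hx : d (ℓ x) < 1
    · obtain ⟨y, hy⟩ := hℓ x hx _ (Nat.one_div_pos_of_nat (n := m))
      exact ⟨y, fun _ => hy⟩
    · exact ⟨0, fun h => (hx h).elim⟩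
  choose w hw using hw
  obtain ⟨T, hST, hT, hclosed⟩ := exists_countable_closed
    (fun (i : (ℚ × ℚ) ⊕ ℕ) (x y : X) =>
      Sum.elim (fun q : ℚ × ℚ => (q.1 : ℝ) • x + (q.2 : ℝ) • y) (fun m => w x m) i)
    (hS.union (Set.countable_singleton 0))
  -- Including `0` made the closed set nonempty, so it can be enumerated by `ℕ`.
  obtain ⟨e, rfl⟩ := hT.exists_eq_range ⟨0, hST (.inr rfl)⟩
  refine ⟨e, Set.subset_union_left.trans hST, fun i j q r => ?_, fun i hi ε hε => ?_⟩
  · obtain ⟨l, hl⟩ := hclosed (.inl (q, r)) _ ⟨i, rfl⟩ _ ⟨j, rfl⟩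
    exact ⟨l, by rw [hl]; simp⟩
  · obtain ⟨m, hm⟩ := exists_nat_one_div_lt hε
    obtain ⟨l, hl⟩ := hclosed (.inr m) _ ⟨i, rfl⟩ _ ⟨i, rfl⟩
    obtain ⟨h1, h2⟩ := hw (e i) m hi
    exact ⟨l, by rw [hl]; exact h1.trans hm, by rw [hl]; exact h2.trans hm⟩

section BackAndForth

variable {M N : Type*} [NormedAddCommGroup M] [InnerProductSpace ℝ M]
    [NormedAddCommGroup N] [InnerProductSpace ℝ N] {dM : M → ℝ} {dN : N → ℝ}

/-- The point `y` cannot be added alone, since the new range must again be dense in a model of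
`T_0`. A whole countable closed family `e` is therefore realized over `f` at once, by saturation. -/
theorem IsPartialIso.exists_extension (hM : IsModelTN dM) (hN : IsRichModel dN)
    {f : ℕ → Ultrapower M} {g : ℕ → N} (h : IsPartialIso (ustar dM) dN f g) (y : N) :
    ∃ (f' : ℕ → Ultrapower M) (g' : ℕ → N), IsPartialIso (ustar dM) dN f' g' ∧
      (∀ i, ∃ j, f' j = f i ∧ g' j = g i) ∧ ∃ j, g' j = y := by
  classical
  obtain ⟨e, hSe, he⟩ := exists_isT0Family (d := dN) (LinearMap.id : N →ₗ[ℝ] N)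
    hN.witness ((Set.countable_range g).union (Set.countable_singleton y))
  simp only [LinearMap.id_apply] at he
  obtain ⟨f', hf1, hf2, hf3⟩ := exists_realization hM.toIsModelT0 f
    (fun i j => inner ℝ (e i) (e j)) (fun i j => inner ℝ (g i) (e j)) (fun i => dN (e i)) (by
      intro s r ε hε
      -- The vectors `g b` are put into the tuple so that the inner products with `f b` are
      -- controlled too.
      obtain ⟨n, ⟨E⟩⟩ := Finite.exists_equiv_fin (s ⊕ r)
      obtain ⟨x, h1, h2, h3⟩ := h.exists_approx (isRichModel_ustar hM).toIsModelTN hN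
        (fun i => Sum.elim (fun a : s => e a) (fun b : r => g b) (E.symm i)) hε
      refine ⟨fun i => if hi : i ∈ s then x (E (.inl ⟨i, hi⟩)) else 0, fun i hi j hj => ?_,
        fun i hi j hj => ?_, fun i hi => ?_⟩
      · simpa [hi, hj] using h1 (E (.inl ⟨i, hi⟩)) (E (.inl ⟨j, hj⟩))
      · simpa [hj] using h3 (E (.inr ⟨i, hi⟩)) i (E (.inl ⟨j, hj⟩)) (by simp)
      · simpa [hi] using h2 (E (.inl ⟨i, hi⟩)))
  refine ⟨f', e, isPartialIso_of_right hf1 hf3 he, fun i => ?_, hSe (.inr rfl)⟩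
  obtain ⟨j, hj⟩ := hSe (.inl ⟨i, rfl⟩)
  refine ⟨j, ?_, hj⟩
  -- The inner products of `f' j` with itself and with `f i` force `f' j = f i` when `e j = g i`.
  have := norm_sub_eq_of_inner_eq (hf1 j j) (h.inner_eq i i)
    (x := f' j) (x' := f i) (by rw [real_inner_comm, hf2, real_inner_comm])
  rwa [hj, sub_self, norm_zero, norm_eq_zero, sub_eq_zero] at this

theorem IsPartialIso.exists_value_snoc_eq (hM : IsModelTN dM) (hN : IsRichModel dN)
    {f : ℕ → Ultrapower M} {g : ℕ → N} (h : IsPartialIso (ustar dM) dN f g) {n r : ℕ}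
    {F : (Fin (n + 1) → Ultrapower M) → ℝ} {G : (Fin (n + 1) → N) → ℝ}
    (hFG : ∀ (f : ℕ → Ultrapower M) (g : ℕ → N), IsPartialIso (ustar dM) dN f g →
      ∀ t : Fin (n + 1) → ℕ, F (fun i => f (t i)) = G fun i => g (t i)) (t : Fin n → ℕ) :
    Set.range (fun y : Metric.closedBall (0 : N) (r : ℝ) =>
      G (Fin.snoc (α := fun _ : Fin (n + 1) => N) (fun i => g (t i)) y)) ⊆
    Set.range fun x : Metric.closedBall (0 : Ultrapower M) (r : ℝ) =>
      F (Fin.snoc (α := fun _ : Fin (n + 1) => Ultrapower M) (fun i => f (t i)) x) := by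
  rintro _ ⟨⟨y, hy⟩, rfl⟩
  obtain ⟨f', g', h', hext, j, rfl⟩ := h.exists_extension hM hN y
  choose s hs1 hs2 using hext
  have hnorm : ‖f' j‖ = ‖g' j‖ := norm_eq_of_inner_eq (h'.inner_eq j j)
  refine ⟨⟨f' j, ?_⟩, ?_⟩
  · rw [mem_closedBall_zero_iff] at hy ⊢
    rwa [hnorm]
  · have key := hFG f' g' h' (Fin.snoc (α := fun _ : Fin (n + 1) => ℕ) (fun i => s (t i)) j)
    convert! key using 2
    · ext i
      refine Fin.lastCases ?_ (fun i => ?_) i <;> simp [hs1]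
    · ext i
      refine Fin.lastCases ?_ (fun i => ?_) i <;> simp [hs2]

theorem IsPartialIso.corr_eval {f : ℕ → M} {g : ℕ → N} (h : IsPartialIso dM dN f g) {n : ℕ}
    (t : Fin n → ℕ) (s : LNTerm n) :
    Corr f g (s.eval fun i => f (t i)) (s.eval fun i => g (t i)) := by
  induction s with
  | var i => exact corr_self _
  | zero => simpa [LNTerm.eval] using h.corr_smul_add_smul (corr_self 0) (corr_self 0) 0 0
  | plus s s' hs hs' => simpa [LNTerm.eval] using h.corr_smul_add_smul hs hs' 1 1
  | scale r s hs => simpa [LNTerm.eval] using h.corr_smul_add_smul hs hs r 0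

/-- Atomic formulas agree because terms at matched tuples correspond in the completions. At a
quantifier, the two extension properties show that the same set of values is taken on both balls, so
its supremum and infimum agree. -/
theorem IsPartialIso.value_eq (hM : IsModelTN dM) (hN : IsModelTN dN) {n : ℕ} (φ : LNFormula n)
    {f : ℕ → Ultrapower M} {g : ℕ → Ultrapower N} (h : IsPartialIso (ustar dM) (ustar dN) f g)
    (t : Fin n → ℕ) :
    φ.value (ustar dM) (fun i => f (t i)) = φ.value (ustar dN) fun i => g (t i) := by
  have hrange : ∀ {n r : ℕ} (φ : LNFormula (n + 1)),
      (∀ {f : ℕ → Ultrapower M} {g : ℕ → Ultrapower N}, IsPartialIso (ustar dM) (ustar dN) f g →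
        ∀ t : Fin (n + 1) → ℕ,
          φ.value (ustar dM) (fun i => f (t i)) = φ.value (ustar dN) fun i => g (t i)) →
      ∀ {f : ℕ → Ultrapower M} {g : ℕ → Ultrapower N}, IsPartialIso (ustar dM) (ustar dN) f g →
      ∀ t : Fin n → ℕ, Set.range (fun x : Metric.closedBall (0 : Ultrapower M) (r : ℝ) =>
        φ.value (ustar dM)
          (Fin.snoc (α := fun _ : Fin (n + 1) => Ultrapower M) (fun i => f (t i)) x)) =
        Set.range fun y : Metric.closedBall (0 : Ultrapower N) (r : ℝ) => φ.value (ustar dN)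
          (Fin.snoc (α := fun _ : Fin (n + 1) => Ultrapower N) (fun i => g (t i)) y) :=
    fun φ ih f g h t => Set.Subset.antisymm
      (h.symm.exists_value_snoc_eq hN (isRichModel_ustar hM)
        (fun _ _ h' t' => (ih h'.symm t').symm) t)
      (h.exists_value_snoc_eq hM (isRichModel_ustar hN) (fun _ _ h' t' => ih h' t') t)
  induction φ generalizing f g with
  | dist s s' =>
    exact (h.corr_eval t s).norm_sub_eq h.inner_eq (h.corr_eval t s')
  | inner s s' =>
    exact (h.corr_eval t s).inner_eq h.inner_eq (h.corr_eval t s')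
  | pred s =>
    exact (h.corr_eval t s).pred_eq (isModelT0_ustar hM.toIsModelT0)
      (isModelT0_ustar hN.toIsModelT0) h.pred_eq
  | conn c φ ih => simp only [LNFormula.value, ih _ h t]
  | sup r φ ih => exact congrArg sSup (hrange φ ih h t)
  | inf r φ ih => exact congrArg sInf (hrange φ ih h t)

end BackAndForth

/-! ### The initial partial isomorphism on the span of A -/

/-- A witness in the closure is moved into the subspace by density, at the cost of half of `ε`. -/
theorem exists_witness_of_isModelT0_closure {M : Type*} [NormedAddCommGroup M]
    [InnerProductSpace ℝ M] {d : M → ℝ} (hd : IsModelT0 d) {V : Submodule ℝ M}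
    (hV : IsModelT0 fun v : V.topologicalClosure => d v) {x : M} (hx : x ∈ V) (hx1 : d x < 1)
    {ε : ℝ} (hε : 0 < ε) : ∃ y ∈ V, |d x - ‖x - y‖| < ε ∧ d y < ε := by
  obtain ⟨⟨y, hy⟩, h1, h2⟩ := hV.witness ⟨x, V.le_topologicalClosure hx⟩ hx1 (ε / 2) (half_pos hε)
  obtain ⟨y', hy', hyy'⟩ := Metric.mem_closure_iff.mp hy (ε / 2) (half_pos hε)
  rw [dist_eq_norm] at hyy'
  change |d x - ‖x - y‖| < ε / 2 at h1
  refine ⟨y', hy', ?_, ?_⟩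
  · have h3 := abs_norm_sub_norm_le (x - y) (x - y')
    rw [sub_sub_sub_cancel_left, norm_sub_rev y' y] at h3
    have h4 := abs_sub_le (d x) ‖x - y‖ ‖x - y'‖
    linarith
  · linarith [(abs_le.mp (hd.abs_sub_le y y')).1]

end HilbertDN

theorem mainTheorem8 {M N A : Type*}
    [NormedAddCommGroup M] [InnerProductSpace ℝ M]
    [NormedAddCommGroup N] [InnerProductSpace ℝ N]
    (dM : M → ℝ) (dN : N → ℝ)
    (hM : HilbertDN.IsModelTN dM) (hN : HilbertDN.IsModelTN dN)
    -- `A` is a common subset of `M` and `N`, and `M` and `N` induce the same structure on its span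
    (a : A → M) (b : A → N)
    (h_inner : ∀ i j : A, inner ℝ (a i) (a j) = inner ℝ (b i) (b j))
    (h_pred : ∀ c : A →₀ ℝ,
      dM (Finsupp.linearCombination ℝ a c) = dN (Finsupp.linearCombination ℝ b c))
    (h_T0 : HilbertDN.IsModelT0
      (fun v : (Submodule.span ℝ (Set.range a)).topologicalClosure => dM v)) :
    HilbertDN.ElemEquivOver dM dN a b := by
  intro n φ t
  have hgram : ∀ c c' : A →₀ ℝ,
      inner ℝ (Finsupp.linearCombination ℝ a c) (Finsupp.linearCombination ℝ a c') =
        inner ℝ (Finsupp.linearCombination ℝ b c) (Finsupp.linearCombination ℝ b c') := by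
    intro c c'
    simp only [Finsupp.linearCombination_apply, Finsupp.sum, sum_inner, inner_sum,
      inner_smul_left, inner_smul_right, h_inner]
  -- `A` may be uncountable, so a countable closed family is extracted. Formal combinations in `A →₀
  -- ℝ` index it in `M` and in `N` simultaneously.
  obtain ⟨e, hSe, he⟩ := HilbertDN.exists_isT0Family (d := HilbertDN.ustar dM)
    (HilbertDN.diag M ∘ₗ Finsupp.linearCombination ℝ a) (by
      intro c hc ε hε
      simp only [LinearMap.comp_apply, ← map_sub, HilbertDN.norm_diag,
        HilbertDN.ustar_diag hM.toIsModelT0] at hc ⊢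
      obtain ⟨y, hy, h1, h2⟩ := HilbertDN.exists_witness_of_isModelT0_closure hM.toIsModelT0 h_T0
        (x := Finsupp.linearCombination ℝ a c)
        (by rw [← Finsupp.range_linearCombination]; exact ⟨c, rfl⟩) hc hε
      rw [← Finsupp.range_linearCombination] at hy
      obtain ⟨c', rfl⟩ := hy
      exact ⟨c', by rwa [map_sub], h2⟩)
    (Set.countable_range fun i => Finsupp.single (t i) (1 : ℝ))
  have hiso : HilbertDN.IsPartialIso (HilbertDN.ustar dM) (HilbertDN.ustar dN)
      (fun i => HilbertDN.diag M (Finsupp.linearCombination ℝ a (e i)))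
      (fun i => HilbertDN.diag N (Finsupp.linearCombination ℝ b (e i))) := by
    refine (HilbertDN.isPartialIso_of_right (fun i j => ?_) (fun i => ?_) he).symm
    · simp only [LinearMap.comp_apply, HilbertDN.inner_diag, hgram]
    · simp only [LinearMap.comp_apply, HilbertDN.ustar_diag hM.toIsModelT0,
        HilbertDN.ustar_diag hN.toIsModelT0, h_pred]
  choose s hs using fun i => hSe ⟨i, rfl⟩
  have key := hiso.value_eq hM hN φ s
  simp only [hs, Finsupp.linearCombination_single, one_smul] at key
  rwa [HilbertDN.value_diag hM.toIsModelT0, HilbertDN.value_diag hN.toIsModelT0] at key
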